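/- Let $V\ge 2$ views share $d_c\ge 1$ common components, and let view $v$ have $p_v\ge 0$ private ones; put $d_v=d_c+p_v$, $d=d_c+\sum_v p_v$. Let $\mathcal Z\subset\mathbb R^d$ be a convex body (compact, convex, with nonempty interior). A latent source is $z=(c,p^1,\dots,p^V)\in\mathcal Z$ with $c\in\mathbb R^{d_c}$, $p^v\in\mathbb R^{p_v}$; its view sources are $z^v=(c,p^v)$, and $\mathcal Z^v=\{z^v : z\in\mathcal Z\}\subset\mathbb R^{d_v}$. View $v$ observes $x^v=g^v(z^v)$, where $g^v:\mathcal Z^v\to\mathbb R^{D_v}$ is continuous and injective. Let $\delta$ be a metric on $\mathbb R^d$ induced by a norm (for instance $\ell_1$). *Data.* Let $A_1,\dots,A_L\in\mathbb R^{d\times d}$ be invertible and let $f^*(z_H)=\sum_{\tau=1}^L A_\tau z_{t-\tau}$ for $z_H=(z_{t-1},\dots,z_{t-L})$. Let $(z,z_H)$ be random with $z_H\in\mathcal Z^L$ almost surely, such that $z$ is uniform on $\mathcal Z$ and, given $z$, the vector $\tilde z=f^*(z_H)$ has density $C_p(z)^{-1}e^{-\delta(z,\tilde z)}$ on $\mathcal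 Z$, where $C_p(z)=\int_{\mathcal Z}e^{-\delta(z,z')}dz'$. Let $z^-_1,z^-_2,\dots$ be independent and uniform on $\mathcal Z$, independent of $(z,z_H)$. *Models.* A model consists of encoders $r^v$ with values in $\mathbb R^{d_v}$, continuous on $g^v(\mathcal Z^v)$, doubly stochastic matrices $B^v\in\mathbb R^{d_v\times d_v}$, and a transition $f(y_1,\dots,y_L)=\sum_\tau \hat A_\tau y_\tau$ with invertible $\hat A_\tau$. Put $\hat z^v=r^v(x^v)$, $\bar z^v=B^v\hat z^v$, let $c^*$ be the mean over $v$ of the vectors $\bar z^v_{1:d_c}$ (equivalently, the minimizer of $\sum_v\|\bar z^v_{1:d_c}-c\|^2$ over $c$), and let $h(z)=(r\circ g)(z)=(c^*,\bar z^1_{d_c+1:d_1},\dots,\bar z^V_{d_c+1:d_V})$. Fix $\mu>0$ and a set $\mathcal W\subseteq\mathbb R^d$ with $\mu\mathcal Z\subseteq\mathcal W$ (for instance $\mathcal W=\mathbb R^d$, or $\mathcal W=\mathcal Z$ if $\mu=1$). A model is admissible if $h(\mathcal Z)\subseteq\mathcal W$ and if almost surely $f(h(z_H))=h(\tilde z)$,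 where $h(z_H)=(h(z_{t-1}),\dots,h(z_{t-L}))$. *Objective.* With $$\mathcal L_{\rm contr}(M)=\mathbb E\left[-\log\frac{e^{-\delta(h(z),f(h(z_H)))/\mu}}{e^{-\delta(h(z),f(h(z_H)))/\mu}+\sum_{i=1}^M e^{-\delta(h(z),h(z_i^-))/\mu}}\right],$$ $$\mathcal L_m=\sum_v\left(\mathbb E\|\bar z^v_{1:d_c}-c^*\|^2-\eta\sum_{i,j}B^v_{ij}\log B^v_{ij}\right),\qquad \eta>0,$$ the objective is $\lim_{M\to\infty}\left(\mathcal L_{\rm contr}(M)-\log M\right)+\beta\mathcal L_m$, with $\beta>0$. *Claim.* If $(r,f,\{B^v\})$ minimizes the objective among all admissible models, then 1. $\delta(h(z),h(z'))=\mu\,\delta(z,z')$ for all $z,z'\in\mathcal Z$; in particular $h$ is an isometry if $\mu=1$; 2. every $B^v$ is a permutation matrix, and for every $z\in\mathcal Z$ the first $d_c$ components of $B^v\hat z^v$ are the same for all views $v$, namely $c^*$; 3. these aligned components represent the common source: for $z,z'\in\mathcal Z$, the vectors $c^*$ of $z$ and $z'$ coincide if and only if $z$ and $z'$ have the same common part $c$.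 -/

import Mathlib

open MeasureTheory Filter Topology Set

noncomputable section

namespace MultiView

/-- Channels of one view: `dc` common ones (the top channels) and `pv` private ones. -/
abbrev ViewIdx (dc pv : ℕ) : Type := Fin dc ⊕ Fin pv

/-- Channels of the complete latent source: the common ones and the private ones of every view. -/
abbrev FullIdx {V : ℕ} (dc : ℕ) (p : Fin V → ℕ) : Type := Fin dc ⊕ (Σ v : Fin V, Fin (p v))

/-- The complete latent space `ℝ^d`, `d = dc + ∑ v, p v`. -/
abbrev Latent {V : ℕ} (dc : ℕ) (p : Fin V → ℕ) : Type := FullIdx dc p → ℝ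

/-- The source of view `v`: the common components together with the private components of `v`.
(Any other order of the components in a view can be absorbed into the mixing map of that view.) -/
def viewSource {V dc : ℕ} {p : Fin V → ℕ} (v : Fin V) (z : Latent dc p) :
    ViewIdx dc (p v) → ℝ :=
  Sum.elim (fun i => z (Sum.inl i)) (fun j => z (Sum.inr ⟨v, j⟩))

/-- Latent space of view `v`. -/
def viewSpace {V dc : ℕ} {p : Fin V → ℕ} (Z : Set (Latent dc p)) (v : Fin V) :
    Set (ViewIdx dc (p v) → ℝ) :=
  viewSource v '' Z

/-- Noiseless vector autoregressive transition `∑ τ, A_τ z_{t-τ}` with `L` lags. -/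
def transition {ι : Type*} [Fintype ι] {L : ℕ} (A : Fin L → Matrix ι ι ℝ)
    (zH : Fin L → ι → ℝ) : ι → ℝ :=
  ∑ τ, (A τ).mulVec (zH τ)

/-- The uniform distribution on `Z`. -/
def unif {ι : Type*} [Fintype ι] (Z : Set (ι → ℝ)) : Measure (ι → ℝ) :=
  ProbabilityTheory.cond volume Z

/-- The partition function `C_p(z) = ∫_Z exp (-δ(z, z'))  dz'`, where `δ(x, y) = N (x - y)`. -/
def partitionFn {ι : Type*} [Fintype ι] (N : Seminorm ℝ (ι → ℝ)) (Z : Set (ι → ℝ))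
    (z : ι → ℝ) : ℝ :=
  ∫ z' in Z, Real.exp (-N (z - z'))

/-- The law of a true positive pair `(z, z')`: `z` is uniform on `Z`, and given `z` the point `z'`
has the density `C_p(z)⁻¹ exp (-δ(z, z'))` on `Z`. -/
def positiveLaw {ι : Type*} [Fintype ι] (N : Seminorm ℝ (ι → ℝ)) (Z : Set (ι → ℝ)) :
    Measure ((ι → ℝ) × (ι → ℝ)) :=
  ((unif Z).prod (volume.restrict Z)).withDensity fun q =>
    ENNReal.ofReal ((partitionFn N Z q.1)⁻¹ * Real.exp (-N (q.1 - q.2)))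

/-- What is learned: one encoder `r^v` per view, the matrices `B^v` of the merge operator, and the
matrices of the estimated causal transition `f`. -/
structure Model {V : ℕ} (dc : ℕ) (p D : Fin V → ℕ) (L : ℕ) where
  r : ∀ v, EuclideanSpace ℝ (Fin (D v)) → ViewIdx dc (p v) → ℝ
  B : ∀ v, Matrix (ViewIdx dc (p v)) (ViewIdx dc (p v)) ℝ
  A : Fin L → Matrix (FullIdx dc p) (FullIdx dc p) ℝ

/-- The entropy `R(B) = -∑ B_ij log B_ij` of a matrix with nonnegative entries. -/
def entropy {ι : Type*} [Fintype ι] (B : Matrix ι ι ℝ) : ℝ :=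
  ∑ i, ∑ j, Real.negMulLog (B i j)

variable {V dc L : ℕ} {p D : Fin V → ℕ}

/-- The estimated source of view `v`, as a function of the true latent source. -/
def Model.est (θ : Model dc p D L)
    (g : ∀ v, (ViewIdx dc (p v) → ℝ) → EuclideanSpace ℝ (Fin (D v)))
    (v : Fin V) (z : Latent dc p) : ViewIdx dc (p v) → ℝ :=
  θ.r v (g v (viewSource v z))

/-- `B^v` applied to the estimated source of view `v`. -/
def Model.sorted (θ : Model dc p D L)
    (g : ∀ v, (ViewIdx dc (p v) → ℝ) → EuclideanSpace ℝ (Fin (D v)))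
    (v : Fin V) (z : Latent dc p) : ViewIdx dc (p v) → ℝ :=
  (θ.B v).mulVec (θ.est g v z)

/-- The center `c*` of the top `dc` sorted channels of all views. Being their mean, it is the
minimizer over `c` of the sum over the views of the squared Euclidean distances to `c`. -/
def Model.center (θ : Model dc p D L)
    (g : ∀ v, (ViewIdx dc (p v) → ℝ) → EuclideanSpace ℝ (Fin (D v)))
    (z : Latent dc p) (i : Fin dc) : ℝ :=
  (∑ v, θ.sorted g v z (Sum.inl i)) / V

theorem Model.center_isLeast (hV : 0 < V) (θ : Model dc p D L)
    (g : ∀ v, (ViewIdx dc (p v) → ℝ) → EuclideanSpace ℝ (Fin (D v)))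
    (z : Latent dc p) (c : Fin dc → ℝ) :
    ∑ v, ∑ i, (θ.sorted g v z (Sum.inl i) - θ.center g z i) ^ 2 ≤
      ∑ v, ∑ i, (θ.sorted g v z (Sum.inl i) - c i) ^ 2 := by
  rw [Finset.sum_comm, Finset.sum_comm (s := Finset.univ (α := Fin V))]
  refine Finset.sum_le_sum fun i _ => ?_
  have hV' : (V : ℝ) ≠ 0 := by positivity
  have h1 : ∑ v, θ.sorted g v z (Sum.inl i) = V * θ.center g z i := by
    unfold Model.center
    field_simp
  have h2 : ∀ a : ℝ, ∑ v, (θ.sorted g v z (Sum.inl i) - a) ^ 2 =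
      ∑ v, θ.sorted g v z (Sum.inl i) ^ 2 - 2 * a * (V * θ.center g z i) + V * a ^ 2 := by
    intro a
    rw [← h1, Finset.mul_sum, ← Finset.sum_sub_distrib]
    have : (V : ℝ) * a ^ 2 = ∑ _v : Fin V, a ^ 2 := by simp
    rw [this, ← Finset.sum_add_distrib]
    exact Finset.sum_congr rfl fun v _ => by ring
  rw [h2, h2]
  nlinarith [mul_nonneg (Nat.cast_nonneg (α := ℝ) V) (sq_nonneg (θ.center g z i - c i))]

/-- The map `h = r ∘ g` from the true to the estimated complete source, where `r` merges the view
estimates: the center `c*`, followed by the remaining sorted channels of every view. -/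
def Model.h (θ : Model dc p D L)
    (g : ∀ v, (ViewIdx dc (p v) → ℝ) → EuclideanSpace ℝ (Fin (D v)))
    (z : Latent dc p) : Latent dc p :=
  Sum.elim (θ.center g z) (fun vj => θ.sorted g vj.1 z (Sum.inr vj.2))

/-- The contrastive loss with `M` negative samples. `P` is the joint law of the present latent
source and its `L` predecessors, a positive pair is the estimate of the present source together
with its prediction from the estimated predecessors, and negatives are the estimates of
independent samples of the marginal (uniform) distribution. -/
def contrastiveLoss (N : Seminorm ℝ (Latent dc p)) (Z : Set (Latent dc p))
    (g : ∀ v, (ViewIdx dc (p v) → ℝ) → EuclideanSpace ℝ (Fin (D v)))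
    (P : Measure (Latent dc p × (Fin L → Latent dc p))) (μ : ℝ) (M : ℕ)
    (θ : Model dc p D L) : ℝ :=
  ∫ w : (Latent dc p × (Fin L → Latent dc p)) × (Fin M → Latent dc p),
    -Real.log
      (Real.exp (-N (θ.h g w.1.1 - transition θ.A fun τ => θ.h g (w.1.2 τ)) / μ) /
        (Real.exp (-N (θ.h g w.1.1 - transition θ.A fun τ => θ.h g (w.1.2 τ)) / μ) +
          ∑ i, Real.exp (-N (θ.h g w.1.1 - θ.h g (w.2 i)) / μ)))
    ∂(P.prod (Measure.pi fun _ : Fin M => unif Z))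

/-- The merge loss: the transport cost to the center plus the entropy penalty. -/
def mergeLoss (Z : Set (Latent dc p))
    (g : ∀ v, (ViewIdx dc (p v) → ℝ) → EuclideanSpace ℝ (Fin (D v)))
    (η : ℝ) (θ : Model dc p D L) : ℝ :=
  ∑ v, ((∫ z, ∑ i, (θ.sorted g v z (Sum.inl i) - θ.center g z i) ^ 2 ∂(unif Z)) +
    η * entropy (θ.B v))

/-- `ℓ` is the limit, for `M → ∞`, of the normalized multi-view objective
`L_contr - log M + β L_m`. -/
def HasLimitObjective (N : Seminorm ℝ (Latent dc p)) (Z : Set (Latent dc p))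
    (g : ∀ v, (ViewIdx dc (p v) → ℝ) → EuclideanSpace ℝ (Fin (D v)))
    (P : Measure (Latent dc p × (Fin L → Latent dc p))) (μ η β : ℝ)
    (θ : Model dc p D L) (ℓ : ℝ) : Prop :=
  Tendsto (fun M : ℕ => contrastiveLoss N Z g P μ M θ - Real.log M + β * mergeLoss Z g η θ)
    atTop (𝓝 ℓ)

/-- The models over which the objective is minimized: the encoders are continuous on the observed
data, the `B^v` are doubly stochastic, the transition matrices have full rank, the estimates lie
in `W`, and the estimated transition, applied to the estimated predecessors, is the estimate
`h(z')` of the transited source `z'`. -/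
structure Admissible (Z W : Set (Latent dc p))
    (g : ∀ v, (ViewIdx dc (p v) → ℝ) → EuclideanSpace ℝ (Fin (D v)))
    (A : Fin L → Matrix (FullIdx dc p) (FullIdx dc p) ℝ)
    (P : Measure (Latent dc p × (Fin L → Latent dc p))) (θ : Model dc p D L) : Prop where
  continuousOn : ∀ v, ContinuousOn (θ.r v) (g v '' viewSpace Z v)
  doublyStochastic : ∀ v, θ.B v ∈ doublyStochastic ℝ (ViewIdx dc (p v))
  fullRank : ∀ τ, IsUnit (θ.A τ).det
  mapsTo : MapsTo (θ.h g) Z W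
  transition_eq : ∀ᵐ q ∂P, transition θ.A (fun τ => θ.h g (q.2 τ)) = θ.h g (transition A q.2)

/-- `θ` minimizes the multi-view objective for `M → ∞` among all admissible models. -/
def IsMinimizer (N : Seminorm ℝ (Latent dc p)) (Z W : Set (Latent dc p))
    (g : ∀ v, (ViewIdx dc (p v) → ℝ) → EuclideanSpace ℝ (Fin (D v)))
    (A : Fin L → Matrix (FullIdx dc p) (FullIdx dc p) ℝ)
    (P : Measure (Latent dc p × (Fin L → Latent dc p))) (μ η β : ℝ)
    (θ : Model dc p D L) : Prop :=
  Admissible Z W g A P θ ∧ ∃ ℓ, HasLimitObjective N Z g P μ η β θ ℓ ∧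
    ∀ θ' : Model dc p D L, Admissible Z W g A P θ' →
      ∀ ℓ', HasLimitObjective N Z g P μ η β θ' ℓ' → ℓ ≤ ℓ'

end MultiView

end

/-! After subtraction of `log M`, the contrastive loss tends to the cross entropy of the model
conditional density, proportional to `exp (-δ(h z, h z') / μ)`, relative to the true one,
proportional to `exp (-δ(z, z'))`. Admissibility matters here: it replaces the predicted source by
`h` of the transited one, so that a positive pair is a pair `(h z, h z̃)`.

By Gibbs' inequality (`ae_eq_of_crossEntropy_le`) this cross entropy is smallest exactly when both
densities agree, and the merge loss is nonnegative. The model inverting the mixing maps up to the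
factor `μ` attains both lower bounds at once, so every minimizer does too. Equality of the densities
makes `δ(z, z')` and `δ(h z, h z') / μ` differ by a function of `z` only. By continuity this holds
on all of `Z × Z`, and the diagonal shows that the function vanishes. A zero merge loss means zero
entropy, which turns a doubly stochastic matrix into a permutation matrix, and top channels that
agree with their center.

The third claim needs `h` to be affine. The norm need not be strictly convex and `h` is not known to
map onto a convex set, so the Mazur-Ulam theorem does not apply directly. A local version on
intersections of two balls (`map_midpoint_of_isometric`) gives additivity of small steps, and a
point of differentiability supplies the linear part `T`. Since `c*` can be read from any single
view, `T` sends each direction invisible to some view to a vector with zero common part. With two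
views these directions span all private ones, so `T` induces a surjective, hence bijective,
endomorphism of the common space (`commonPart_eq_zero_iff_of_viewSource`). -/

/-! ### Isometries of compact and of bounded metric spaces. -/

/-- A point `x` outside the compact range has distance at least some `ε` from it. Isometry
propagates this gap, so the orbit of `x` is `ε`-separated and has no Cauchy subsequence. -/
theorem Isometry.surjective_of_compactSpace {X : Type*} [MetricSpace X] [CompactSpace X]
    {f : X → X} (hf : Isometry f) : Function.Surjective f := by
  intro x
  by_contra hx
  have hcl : IsClosed (range f) := (isCompact_range hf.continuous).isClosed
  obtain ⟨ε, hε, hball⟩ := Metric.isOpen_iff.1 hcl.isOpen_compl x hx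
  have hsep : ∀ y, ε ≤ dist (f y) x := fun y => by
    by_contra! h
    exact hball (Metric.mem_ball.2 h) (mem_range_self y)
  have hiter : ∀ m k : ℕ, ε ≤ dist (f^[m + (k + 1)] x) (f^[m] x) := by
    intro m k
    induction m with
    | zero => simpa [Function.iterate_succ_apply'] using hsep (f^[k] x)
    | succ m ih =>
      rwa [Nat.succ_add, Function.iterate_succ_apply', Function.iterate_succ_apply', hf.dist_eq]
  obtain ⟨a, -, φ, hφ, hlim⟩ := isCompact_univ.tendsto_subseq (x := fun n => f^[n] x)
    (fun n => mem_univ _)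
  obtain ⟨n₀, hn₀⟩ := Metric.cauchySeq_iff.1 hlim.cauchySeq ε hε
  have h1 := hn₀ (n₀ + 1) (Nat.le_succ _) n₀ le_rfl
  have h2 : φ n₀ < φ (n₀ + 1) := hφ (Nat.lt_succ_self _)
  obtain ⟨k, hk⟩ := Nat.exists_eq_add_of_lt h2
  simp only [Function.comp_apply, hk] at h1
  exact absurd h1 (not_lt.2 (hiter (φ n₀) k))

/-- In a bounded space, a point reflection forces its center to be fixed by every isometry. -/
theorem IsometryEquiv.fixes_center_of_reflection {X : Type*} [MetricSpace X] [BoundedSpace X]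
    {m : X} (ρ : X ≃ᵢ X) (hm : ρ m = m) (hρ : ∀ x, dist (ρ x) x = 2 * dist x m) (e : X ≃ᵢ X) :
    e m = m := by
  -- The commutator-like map `ρ e⁻¹ ρ e` moves `m` twice as far as `e` does. Iterating this
  -- construction would exceed the diameter unless `e` fixes `m`.
  have hstep : ∀ e : X ≃ᵢ X, dist ((((e.trans ρ).trans e.symm).trans ρ) m) m =
      2 * dist (e m) m := by
    intro e
    have h1 : dist (ρ (e.symm (ρ (e m)))) (ρ m) = dist (e (e.symm (ρ (e m)))) (e m) := by
      rw [ρ.dist_eq, e.dist_eq]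
    simp only [IsometryEquiv.trans_apply]
    rw [hm, e.apply_symm_apply] at h1
    rw [h1, hρ]
  have hpow : ∀ n : ℕ, ∀ e : X ≃ᵢ X, 2 ^ n * dist (e m) m ≤ Metric.diam (univ : Set X) := by
    intro n
    induction n with
    | zero =>
      intro e
      simpa using Metric.dist_le_diam_of_mem (Bornology.IsBounded.all _) (mem_univ (e m))
        (mem_univ m)
    | succ n ih =>
      intro e
      have := ih (((e.trans ρ).trans e.symm).trans ρ)
      rw [hstep] at this
      rw [pow_succ]
      linarith
  by_contra h
  have hpos : 0 < dist (e m) m := dist_pos.2 h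
  obtain ⟨n, hn⟩ := pow_unbounded_of_one_lt (Metric.diam (univ : Set X) / dist (e m) m)
    (one_lt_two (α := ℝ))
  rw [div_lt_iff₀ hpos] at hn
  exact absurd hn (not_lt.2 (hpow n e))

/-! ### Isometries of convex bodies: a local Mazur-Ulam theorem. -/

section Convex

variable {E : Type*} [NormedAddCommGroup E] [NormedSpace ℝ E]

theorem Convex.subset_closure_interior {Z : Set E} (hZconv : Convex ℝ Z) (hZint : (interior Z).Nonempty) :
    Z ⊆ closure (interior Z) := by
  rw [hZconv.closure_interior_eq_closure_of_nonempty_interior hZint]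
  exact subset_closure

/-- Translating the center `f x` back to `x` gives an isometry of a compact ball into itself, which
is automatically onto. Surjectivity onto balls replaces the global surjectivity assumed by
Mazur-Ulam. -/
theorem image_closedBall_of_isometric [FiniteDimensional ℝ E] {f : E → E} {x : E} {r : ℝ} (hr : 0 ≤ r)
    (hf : ∀ y ∈ Metric.closedBall x r, ∀ z ∈ Metric.closedBall x r,
      dist (f y) (f z) = dist y z) :
    f '' Metric.closedBall x r = Metric.closedBall (f x) r := by
  have hx : x ∈ Metric.closedBall x r := Metric.mem_closedBall_self hr
  apply Subset.antisymm
  · rintro _ ⟨y, hy, rfl⟩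
    rw [Metric.mem_closedBall, hf y hy x hx]
    exact hy
  · intro y hy
    have : ProperSpace E := FiniteDimensional.proper_real E
    have : CompactSpace (Metric.closedBall x r) :=
      isCompact_iff_compactSpace.1 (isCompact_closedBall x r)
    let k : Metric.closedBall x r → Metric.closedBall x r := fun u =>
      ⟨f u - f x + x, by
        rw [Metric.mem_closedBall, dist_eq_norm, add_sub_cancel_right, ← dist_eq_norm,
          hf u u.2 x hx]
        exact u.2⟩
    have hk : Isometry k := Isometry.of_dist_eq fun u v => by
      simp only [k, Subtype.dist_eq, dist_add_right, dist_sub_right]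
      exact hf u u.2 v v.2
    obtain ⟨u, hu⟩ := hk.surjective_of_compactSpace ⟨y - f x + x, by
      rw [Metric.mem_closedBall, dist_eq_norm] at hy
      rwa [Metric.mem_closedBall, dist_eq_norm, add_sub_cancel_right]⟩
    refine ⟨u, u.2, ?_⟩
    simpa [k] using hu

/-- The point reflection of a set which is symmetric about `m`. -/
def reflectionOn (S : Set E) (m : E) (hS : ∀ x ∈ S, (2 : ℝ) • m - x ∈ S) : S ≃ᵢ S where
  toFun x := ⟨(2 : ℝ) • m - x, hS x x.2⟩
  invFun x := ⟨(2 : ℝ) • m - x, hS x x.2⟩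
  left_inv x := by simp
  right_inv x := by simp
  isometry_toFun := Isometry.of_dist_eq fun x y => by
    simp only [Subtype.dist_eq, dist_sub_left]

theorem dist_reflectionOn {S : Set E} {m : E} (hS : ∀ x ∈ S, (2 : ℝ) • m - x ∈ S) (hm : m ∈ S)
    (x : S) : dist (reflectionOn S m hS x) x = 2 * dist x ⟨m, hm⟩ := by
  rw [Subtype.dist_eq, Subtype.dist_eq, dist_comm, dist_eq_norm, dist_eq_norm]
  have : (x : E) - (reflectionOn S m hS x : E) = (2 : ℝ) • ((x : E) - m) := by
    simp only [reflectionOn, IsometryEquiv.coe_mk, Equiv.coe_fn_mk]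
    module
  rw [this, norm_smul]
  simp

/-- A local version of the Mazur-Ulam theorem. -/
theorem map_midpoint_of_isometric [FiniteDimensional ℝ E] {f : E → E} {m u : E}
    (hf : ∀ y ∈ Metric.closedBall (m - u) ‖u‖ ∪ Metric.closedBall (m + u) ‖u‖,
      ∀ z ∈ Metric.closedBall (m - u) ‖u‖ ∪ Metric.closedBall (m + u) ‖u‖,
      dist (f y) (f z) = dist y z) :
    (2 : ℝ) • f m = f (m - u) + f (m + u) := by
  set B₁ := Metric.closedBall (m - u) ‖u‖ with hB₁
  set B₂ := Metric.closedBall (m + u) ‖u‖ with hB₂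
  set S := B₁ ∩ B₂ with hSdef
  set S' := Metric.closedBall (f (m - u)) ‖u‖ ∩ Metric.closedBall (f (m + u)) ‖u‖ with hSdef'
  have hinj : InjOn f (B₁ ∪ B₂) := fun y hy z hz h => by
    rw [← dist_eq_zero, ← hf y hy z hz, h, dist_self]
  have h1 := image_closedBall_of_isometric (norm_nonneg u) (f := f) (x := m - u)
    fun y hy z hz => hf y (Or.inl hy) z (Or.inl hz)
  have h2 := image_closedBall_of_isometric (norm_nonneg u) (f := f) (x := m + u)
    fun y hy z hz => hf y (Or.inr hy) z (Or.inr hz)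
  -- The lens `S` has `m` as its center of symmetry and is defined by distances to `m - u` and `m +
  -- u` only, so its image is the lens of the image points, with center `m'`.
  have himage : f '' S = S' := by
    rw [hSdef, hSdef', ← h1, ← h2]
    exact hinj.image_inter subset_union_left subset_union_right
  have hm : m ∈ S := by
    constructor <;> simp [hB₁, hB₂, dist_eq_norm]
  have hrefl : ∀ x ∈ S, (2 : ℝ) • m - x ∈ S := by
    rintro x ⟨hx1, hx2⟩
    rw [hB₁, Metric.mem_closedBall, dist_eq_norm] at hx1
    rw [hB₂, Metric.mem_closedBall, dist_eq_norm] at hx2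
    refine ⟨?_, ?_⟩
    · rw [hB₁, Metric.mem_closedBall, dist_eq_norm, ← norm_neg]
      convert hx2 using 1
      congr 1
      module
    · rw [hB₂, Metric.mem_closedBall, dist_eq_norm, ← norm_neg]
      convert hx1 using 1
      congr 1
      module
  set m' : E := (2⁻¹ : ℝ) • (f (m - u) + f (m + u)) with hm'
  have hrefl' : ∀ x ∈ S', (2 : ℝ) • m' - x ∈ S' := by
    rintro x ⟨hx1, hx2⟩
    rw [Metric.mem_closedBall, dist_eq_norm] at hx1
    rw [Metric.mem_closedBall, dist_eq_norm] at hx2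
    refine ⟨?_, ?_⟩
    · rw [Metric.mem_closedBall, dist_eq_norm, ← norm_neg]
      convert hx2 using 1
      congr 1
      rw [hm']
      module
    · rw [Metric.mem_closedBall, dist_eq_norm, ← norm_neg]
      convert hx1 using 1
      congr 1
      rw [hm']
      module
  let F : S ≃ᵢ S' :=
    { toEquiv := (Equiv.Set.imageOfInjOn f S (hinj.mono fun x hx => Or.inl hx.1)).trans
        (Equiv.setCongr himage)
      isometry_toFun := Isometry.of_dist_eq fun x y => hf x (Or.inl x.2.1) y (Or.inl y.2.1) }
  have : BoundedSpace S := by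
    rw [boundedSpace_subtype_iff]
    exact Metric.isBounded_closedBall.subset inter_subset_left
  -- The reflection of `S'`, conjugated by `F`, is an isometry of `S` and therefore fixes `m`. Hence
  -- the reflection of `S'` fixes `f m`, which forces `f m = m'`.
  have hfix : ((F.trans (reflectionOn S' m' hrefl')).trans F.symm) ⟨m, hm⟩ = ⟨m, hm⟩ := by
    apply IsometryEquiv.fixes_center_of_reflection (reflectionOn S m hrefl)
    · rw [← dist_eq_zero, dist_reflectionOn hrefl hm, dist_self, mul_zero]
    · exact dist_reflectionOn hrefl hm
  have h3 : reflectionOn S' m' hrefl' (F ⟨m, hm⟩) = F ⟨m, hm⟩ := by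
    rw [← F.symm_apply_eq]
    exact hfix
  have h4 : (2 : ℝ) • m' - f m = f m := congrArg Subtype.val h3
  rw [hm', smul_smul] at h4
  norm_num at h4
  rw [two_smul]
  nth_rewrite 1 [← h4]
  abel

/-- An isometry of a convex body into the ambient space is affine. -/
theorem exists_linear_of_isometric [FiniteDimensional ℝ E] {f : E → E} {Z : Set E} (hZ : Convex ℝ Z)
    (hint : (interior Z).Nonempty)
    (hf : ∀ y ∈ Z, ∀ z ∈ Z, dist (f y) (f z) = dist y z) :
    ∃ T : E →L[ℝ] E, ∃ w ∈ interior Z, ∀ z ∈ Z, f z = f w + T (z - w) := by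
  let : MeasurableSpace E := borel E
  have : BorelSpace E := ⟨rfl⟩
  have hlip : LipschitzOnWith 1 f Z := LipschitzOnWith.of_dist_le_mul fun y hy z hz => by
    simp [hf y hy z hz]
  -- Rademacher's theorem; a single differentiability point `w` in the interior is enough.
  have hdiff := hlip.ae_differentiableWithinAt_of_mem (μ := Measure.addHaar)
  obtain ⟨w, hw, hwd⟩ : ∃ w ∈ interior Z, DifferentiableWithinAt ℝ f Z w := by
    by_contra! h
    have h0 : Measure.addHaar (interior Z) = 0 := by
      refine measure_mono_null (fun w hw => ?_) (ae_iff.1 hdiff)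
      simp only [mem_ofPred_eq, Classical.not_imp]
      exact ⟨interior_subset hw, h w hw⟩
    exact isOpen_interior.measure_ne_zero _ hint h0
  have hderiv := (hwd.differentiableAt (mem_interior_iff_mem_nhds.1 hw)).hasFDerivAt
  refine ⟨fderiv ℝ f w, w, hw, ?_⟩
  have key : ∀ z ∈ interior Z, f z = f w + fderiv ℝ f w (z - w) := by
    intro z hz
    have hseg : segment ℝ w z ⊆ interior Z := hZ.interior.segment_subset hw hz
    have hcpt : IsCompact (segment ℝ w z) := by
      rw [segment_eq_image']
      exact isCompact_Icc.image (by fun_prop)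
    obtain ⟨ε, hε, hthick⟩ := hcpt.exists_cthickening_subset_open
      isOpen_interior hseg
    have hball : ∀ x ∈ segment ℝ w z, Metric.closedBall x ε ⊆ Z := fun x hx =>
      (Metric.closedBall_subset_cthickening hx ε).trans (hthick.trans interior_subset)
    -- The rescaled increments `n • (f (w + (z - w) / n) - f w)` tend to the derivative at `z - w`.
    -- They are shown to equal `f z - f w` as soon as the step is shorter than `ε`, so the limit is
    -- already attained.
    have hlim := hderiv.lim (z - w) (c := fun n : ℕ => (n : ℝ)) (l := atTop) (by
      simpa using tendsto_natCast_atTop_atTop (R := ℝ))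
    have hev : ∀ᶠ n : ℕ in atTop,
        (n : ℝ) • (f (w + (n : ℝ)⁻¹ • (z - w)) - f w) = f z - f w := by
      obtain ⟨n₀, hn₀⟩ := exists_nat_gt (‖z - w‖ / ε)
      filter_upwards [eventually_ge_atTop (max n₀ 1)] with n hn
      have hn1 : 1 ≤ n := (le_max_right _ _).trans hn
      have hnpos : (0 : ℝ) < n := by exact_mod_cast hn1
      have hsmall : ‖(n : ℝ)⁻¹ • (z - w)‖ ≤ ε := by
        have : (n₀ : ℝ) ≤ n := by exact_mod_cast (le_max_left _ _).trans hn
        rw [norm_smul, norm_inv, Real.norm_natCast, inv_mul_le_iff₀ hnpos, ← div_le_iff₀ hε]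
        linarith
      set u := (n : ℝ)⁻¹ • (z - w) with hu
      have hmem : ∀ i : ℕ, i ≤ n → w + (i : ℝ) • u ∈ segment ℝ w z := by
        intro i hi
        rw [segment_eq_image']
        refine ⟨(i : ℝ) / n, ⟨by positivity, ?_⟩, ?_⟩
        · rw [div_le_one hnpos]
          exact_mod_cast hi
        · simp only [hu, smul_smul, div_eq_mul_inv]
      -- Midpoints are preserved along the segment, since the balls of radius `‖u‖` around its
      -- division points stay in `Z`; hence all increments of `f` over steps `u` are equal.
      have hmid : ∀ i : ℕ, i + 2 ≤ n →
          f (w + ((i + 2 : ℕ) : ℝ) • u) - f (w + ((i + 1 : ℕ) : ℝ) • u) =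
            f (w + ((i + 1 : ℕ) : ℝ) • u) - f (w + (i : ℝ) • u) := by
        intro i hi
        have e1 : w + ((i + 1 : ℕ) : ℝ) • u - u = w + (i : ℝ) • u := by push_cast; module
        have e2 : w + ((i + 1 : ℕ) : ℝ) • u + u = w + ((i + 2 : ℕ) : ℝ) • u := by
          push_cast; module
        have := map_midpoint_of_isometric (f := f) (m := w + ((i + 1 : ℕ) : ℝ) • u) (u := u) (by
          have hsub : Metric.closedBall (w + ((i + 1 : ℕ) : ℝ) • u - u) ‖u‖ ∪
              Metric.closedBall (w + ((i + 1 : ℕ) : ℝ) • u + u) ‖u‖ ⊆ Z := by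
            rw [e1, e2]
            exact union_subset
              ((Metric.closedBall_subset_closedBall hsmall).trans (hball _ (hmem i (by omega))))
              ((Metric.closedBall_subset_closedBall hsmall).trans (hball _ (hmem _ hi)))
          exact fun y hy z hz => hf y (hsub hy) z (hsub hz))
        rw [e1, e2, two_smul] at this
        rw [sub_eq_sub_iff_add_eq_add, add_comm, ← this]
      have hstep : ∀ i : ℕ, i + 1 ≤ n →
          f (w + ((i + 1 : ℕ) : ℝ) • u) - f (w + (i : ℝ) • u) = f (w + u) - f w := by
        intro i
        induction i with
        | zero => intro _; simp
        | succ i ih => intro hi; rw [hmid i hi, ih (by omega)]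
      have hsum : ∀ i : ℕ, i ≤ n → f (w + (i : ℝ) • u) - f w = (i : ℝ) • (f (w + u) - f w) := by
        intro i
        induction i with
        | zero => intro _; simp
        | succ i ih =>
          intro hi
          rw [← sub_add_sub_cancel _ (f (w + (i : ℝ) • u)), hstep i hi, ih (by omega)]
          push_cast
          module
      have hz' : w + (n : ℝ) • u = z := by
        rw [hu, smul_smul, mul_inv_cancel₀ hnpos.ne', one_smul, add_sub_cancel]
      rw [← hsum n le_rfl, hz']
    have := tendsto_nhds_unique (hlim.congr' hev) tendsto_const_nhds
    rw [this, add_sub_cancel]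
  exact EqOn.of_subset_closure key hlip.continuousOn (by fun_prop) interior_subset
    (hZ.subset_closure_interior hint)

end Convex

/-! ### Transfer to an arbitrary norm and to similarities. -/

/-- A copy of `E`, to be normed by a seminorm `N` on `E` which separates points. -/
def NormCopy {E : Type*} [AddCommGroup E] [Module ℝ E] (_N : Seminorm ℝ E) : Type _ := E

section NormCopy

variable {E : Type*} [AddCommGroup E] [Module ℝ E] (N : Seminorm ℝ E)

instance : AddCommGroup (NormCopy N) := inferInstanceAs (AddCommGroup E)
instance : Module ℝ (NormCopy N) := inferInstanceAs (Module ℝ E)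
instance : Norm (NormCopy N) := ⟨fun x => N x⟩

/-- The identity, as a map to the normed copy. -/
def toNormCopy : E ≃ₗ[ℝ] NormCopy N := LinearEquiv.refl ℝ E

theorem norm_toNormCopy (x : E) : ‖toNormCopy N x‖ = N x := rfl

theorem NormCopy.core (hN : ∀ x, N x = 0 → x = 0) : NormedSpace.Core ℝ (NormCopy N) where
  norm_nonneg x := apply_nonneg N x
  norm_smul c x := map_smul_eq_mul N c x
  norm_triangle x y := map_add_le_add N x y
  norm_eq_zero_iff x := ⟨hN x, fun h => by subst h; exact map_zero N⟩

end NormCopy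

/-- A map of a convex body into the ambient space which scales all distances by the same factor
is affine, whatever the norm. -/
theorem Seminorm.exists_linear_of_isometric {E : Type*} [NormedAddCommGroup E] [NormedSpace ℝ E]
    [FiniteDimensional ℝ E] (N : Seminorm ℝ E) (hN : ∀ x, N x = 0 → x = 0) {f : E → E} {Z : Set E}
    (hZ : Convex ℝ Z) (hint : (interior Z).Nonempty) {μ : ℝ} (hμ : 0 < μ)
    (hf : ∀ y ∈ Z, ∀ z ∈ Z, N (f y - f z) = μ * N (y - z)) :
    ∃ T : E →ₗ[ℝ] E, ∃ w ∈ interior Z, ∀ z ∈ Z, f z = f w + T (z - w) := by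
  let : NormedAddCommGroup (NormCopy N) := NormedAddCommGroup.ofCore (NormCopy.core N hN)
  let : NormedSpace ℝ (NormCopy N) := NormedSpace.ofCore (NormCopy.core N hN)
  -- In finite dimension the identity is a homeomorphism between the two norms, so convex bodies and
  -- their interiors are the same for both.
  let e : E ≃L[ℝ] NormCopy N := (toNormCopy N).toContinuousLinearEquiv
  have hnorm : ∀ x, ‖e x‖ = N x := norm_toNormCopy N
  have : FiniteDimensional ℝ (NormCopy N) := (toNormCopy N).finiteDimensional
  -- Division by `μ` turns the similarity into an isometry; the factor is restored in the linear
  -- part.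
  obtain ⟨T, w, hw, hT⟩ := _root_.exists_linear_of_isometric (E := NormCopy N)
    (f := fun x => e (μ⁻¹ • f (e.symm x))) (Z := e.symm ⁻¹' Z)
    (hZ.linear_preimage e.symm.toLinearMap)
    (by
      obtain ⟨z, hz⟩ := hint
      refine ⟨e z, ?_⟩
      have := e.symm.toHomeomorph.preimage_interior Z
      have h2 : e z ∈ e.symm ⁻¹' interior Z := by simpa using hz
      exact this ▸ h2)
    (by
      intro y hy z hz
      rw [dist_eq_norm, dist_eq_norm, ← map_sub, ← smul_sub, hnorm, map_smul_eq_mul,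
        hf (e.symm y) hy (e.symm z) hz, Real.norm_of_nonneg (by positivity), inv_mul_cancel_left₀ hμ.ne', ← map_sub,
        ← hnorm, e.apply_symm_apply])
  refine ⟨μ • (e.symm.toLinearMap ∘ₗ T.toLinearMap ∘ₗ e.toLinearMap), e.symm w, ?_, ?_⟩
  · have := e.symm.toHomeomorph.preimage_interior Z
    exact (this.symm ▸ hw : w ∈ e.symm ⁻¹' interior Z)
  · intro z hz
    have h1 := congrArg e.symm (hT (e z) (by simpa using hz))
    simp only [map_add, e.symm_apply_apply] at h1
    have h2 := congrArg (fun x => μ • x) h1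
    simp only [smul_add, smul_smul, mul_inv_cancel₀ hμ.ne', one_smul] at h2
    rw [h2]
    simp

/-! ### Infinitely many negative samples: the limit of the contrastive loss. -/

theorem Real.abs_log_sub_log_le {m x y : ℝ} (hm : 0 < m) (hx : m ≤ x) (hy : m ≤ y) :
    |Real.log x - Real.log y| ≤ m⁻¹ * |x - y| := by
  have key : ∀ {x y : ℝ}, m ≤ x → m ≤ y → Real.log x - Real.log y ≤ m⁻¹ * |x - y| := by
    intro x y hx hy
    have hx0 := hm.trans_le hx
    have hy0 := hm.trans_le hy
    rw [← Real.log_div hx0.ne' hy0.ne']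
    calc Real.log (x / y) ≤ x / y - 1 := Real.log_le_sub_one_of_pos (by positivity)
      _ = y⁻¹ * (x - y) := by field_simp
      _ ≤ y⁻¹ * |x - y| := by gcongr; exact le_abs_self _
      _ ≤ m⁻¹ * |x - y| := by gcongr
  rw [abs_le']
  refine ⟨key hx hy, ?_⟩
  rw [neg_sub, abs_sub_comm]
  exact key hy hx

theorem MeasureTheory.integrable_of_mem_Icc {α : Type*} [MeasurableSpace α] {ν : Measure α}
    [IsFiniteMeasure ν] {f : α → ℝ} (hf : Measurable f) {a b : ℝ} (h : ∀ x, f x ∈ Icc a b) :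
    Integrable f ν :=
  Integrable.of_mem_Icc a b hf.aemeasurable (ae_of_all _ h)

section Sampling

variable {α β : Type*} [MeasurableSpace α] [MeasurableSpace β]

/-- Weak law of large numbers, in mean and with a rate. -/
theorem integral_abs_average_sub_le {σ : Measure β} [IsProbabilityMeasure σ] {X : β → ℝ}
    (hX : Measurable X) (hX01 : ∀ b, X b ∈ Icc (0 : ℝ) 1) {M : ℕ} (hM : 0 < M) :
    ∫ n : Fin M → β, |(∑ i, X (n i)) / M - ∫ b, X b ∂σ| ∂(Measure.pi fun _ => σ) ≤
      (√M)⁻¹ := by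
  set π := Measure.pi fun _ : Fin M => σ
  have hM0 : (0 : ℝ) < M := by exact_mod_cast hM
  have hint : Integrable X σ := integrable_of_mem_Icc hX hX01
  have hmem : MemLp X 2 σ := MemLp.of_bound hX.aestronglyMeasurable 1 (ae_of_all _ fun b => by
    rw [Real.norm_of_nonneg (hX01 b).1]; exact (hX01 b).2)
  have hS : Measurable fun n : Fin M → β => ∑ i, X (n i) := by fun_prop
  have hS_int : ∫ n, ∑ i, X (n i) ∂π = M * ∫ b, X b ∂σ := by
    rw [integral_finsetSum]
    · have : ∀ i : Fin M, ∫ n, X (n i) ∂π = ∫ b, X b ∂σ := fun i =>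
        integral_comp_eval (μ := fun _ : Fin M => σ) (i := i) hX.aestronglyMeasurable
      simp [this]
    · exact fun i _ => (measurePreserving_eval (fun _ : Fin M => σ) i).integrable_comp_of_integrable
        hint
  have hvar : ∫ n, ((∑ i, X (n i)) - M * ∫ b, X b ∂σ) ^ 2 ∂π ≤ M := by
    have h1 := ProbabilityTheory.variance_sum_pi (μ := fun _ : Fin M => σ) (X := fun _ => X)
      (fun _ => hmem)
    have h2 : ProbabilityTheory.variance X σ ≤ 1 := by
      refine (ProbabilityTheory.variance_le_expectation_sq hX.aestronglyMeasurable).trans ?_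
      calc ∫ b, (X ^ 2) b ∂σ ≤ ∫ _b, (1 : ℝ) ∂σ := by
            refine integral_mono_of_nonneg (ae_of_all _ fun b => sq_nonneg _)
              (integrable_const _) (ae_of_all _ fun b => ?_)
            exact pow_le_one₀ (hX01 b).1 (hX01 b).2
        _ = 1 := by simp
    rw [ProbabilityTheory.variance_eq_integral (by
      refine Measurable.aemeasurable ?_
      convert hS using 1
      ext n
      simp)] at h1
    simp only [Finset.sum_apply] at h1
    rw [hS_int] at h1
    rw [h1]
    simp only [Finset.sum_const, Finset.card_univ, Fintype.card_fin, nsmul_eq_mul]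
    nlinarith
  have hsq : 0 < √(M : ℝ) := Real.sqrt_pos.2 hM0
  -- For the deviation `y` of the average, `(√M |y| - 1)² ≥ 0` gives `|y| ≤ √M y² / 2 + 1 / (2√M)`.
  -- The weight balances the two terms, as the variance of the sum is at most `M`.
  have hpt : ∀ n : Fin M → β, |(∑ i, X (n i)) / M - ∫ b, X b ∂σ| ≤
      (√M / (2 * M ^ 2)) * ((∑ i, X (n i)) - M * ∫ b, X b ∂σ) ^ 2 + (2 * √M)⁻¹ := by
    intro n
    set y := (∑ i, X (n i)) / M - ∫ b, X b ∂σ with hy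
    have h1 : (∑ i, X (n i)) - M * ∫ b, X b ∂σ = M * y := by rw [hy]; field_simp
    rw [h1]
    have h2 : (√M / (2 * (M : ℝ) ^ 2)) * (M * y) ^ 2 + (2 * √M)⁻¹ - |y| =
        (√M * |y| - 1) ^ 2 / (2 * √M) := by
      have : y ^ 2 = |y| ^ 2 := (sq_abs y).symm
      rw [mul_pow, this]
      field_simp
      ring
    have h3 : 0 ≤ (√M * |y| - 1) ^ 2 / (2 * √M) := by positivity
    linarith
  have hsqint : Integrable (fun n : Fin M → β =>
      ((∑ i, X (n i)) - M * ∫ b, X b ∂σ) ^ 2) π := by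
    have hb : ∀ n : Fin M → β, ∑ i, X (n i) ∈ Icc (0 : ℝ) M := fun n =>
      ⟨Finset.sum_nonneg fun i _ => (hX01 _).1, by
        simpa using Finset.sum_le_sum fun i (_ : i ∈ Finset.univ) => (hX01 (n i)).2⟩
    have hb' : ∫ b, X b ∂σ ∈ Icc (0 : ℝ) 1 :=
      ⟨integral_nonneg fun b => (hX01 b).1, by
        simpa using integral_mono hint (integrable_const (1 : ℝ)) fun b => (hX01 b).2⟩
    refine integrable_of_mem_Icc (by fun_prop) (a := 0) (b := (M : ℝ) ^ 2) fun n =>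
      ⟨sq_nonneg _, ?_⟩
    have h1 := hb n
    refine sq_le_sq' ?_ ?_ <;> nlinarith [h1.1, h1.2, hb'.1, hb'.2]
  calc ∫ n : Fin M → β, |(∑ i, X (n i)) / M - ∫ b, X b ∂σ| ∂π
      ≤ ∫ n : Fin M → β, ((√M / (2 * M ^ 2)) * ((∑ i, X (n i)) - M * ∫ b, X b ∂σ) ^ 2 +
          (2 * √M)⁻¹) ∂π :=
        integral_mono_of_nonneg (ae_of_all _ fun n => abs_nonneg _)
          ((hsqint.const_mul _).add (integrable_const _)) (ae_of_all _ hpt)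
    _ = (√M / (2 * M ^ 2)) * ∫ n, ((∑ i, X (n i)) - M * ∫ b, X b ∂σ) ^ 2 ∂π +
          (2 * √M)⁻¹ := by
        rw [integral_add (hsqint.const_mul _) (integrable_const _), integral_const_mul]
        simp
    _ ≤ (√M / (2 * M ^ 2)) * M + (2 * √M)⁻¹ := by gcongr
    _ = (√M)⁻¹ := by
        have : (M : ℝ) = √M ^ 2 := (Real.sq_sqrt hM0.le).symm
        field_simp
        rw [← this]
        ring

/-- The large sample limit of a normalized contrastive loss. -/
theorem tendsto_integral_contrastive {ν : Measure α} [IsProbabilityMeasure ν] {σ : Measure β}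
    [IsProbabilityMeasure σ] {U : α → ℝ} {ψ : α → β → ℝ} (hU : Measurable U)
    (hψ : Measurable fun q : α × β => ψ q.1 q.2) {m : ℝ} (hm : 0 < m)
    (hUm : ∀ a, U a ∈ Icc m 1) (hψm : ∀ a b, ψ a b ∈ Icc m 1) :
    Tendsto (fun M : ℕ => ∫ w : α × (Fin M → β),
        -Real.log (U w.1 / (U w.1 + ∑ i, ψ w.1 (w.2 i))) ∂(ν.prod (Measure.pi fun _ => σ)) -
          Real.log M) atTop
      (𝓝 (∫ a, (-Real.log (U a) + Real.log (∫ b, ψ a b ∂σ)) ∂ν)) := by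
  set c : α → ℝ := fun a => ∫ b, ψ a b ∂σ with hc
  have hcmeas : Measurable c :=
    (hψ.stronglyMeasurable.integral_prod_right (ν := σ)).measurable
  have hψa : ∀ a, Measurable (ψ a) := fun a => hψ.comp measurable_prodMk_left
  have hψint : ∀ a, Integrable (ψ a) σ := fun a => integrable_of_mem_Icc (hψa a) (hψm a)
  have hcm : ∀ a, c a ∈ Icc m 1 := fun a =>
    ⟨by simpa using integral_mono (integrable_const m) (hψint a) fun b => (hψm a b).1,
      by simpa using integral_mono (hψint a) (integrable_const (1 : ℝ)) fun b => (hψm a b).2⟩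
  have hlog : ∀ {x : ℝ}, x ∈ Icc m 1 → Real.log x ∈ Icc (Real.log m) 0 := fun hx =>
    ⟨Real.log_le_log hm hx.1, Real.log_nonpos (hm.le.trans hx.1) hx.2⟩
  rw [tendsto_iff_norm_sub_tendsto_zero]
  -- The term `M⁻¹` bounds the contribution of the positive pair to the denominator, `(√M)⁻¹` the
  -- mean sampling error, and `m⁻¹` is the Lipschitz constant of `log` on `[m, ∞)`.
  have hbound : ∀ᶠ M : ℕ in atTop, ‖∫ w : α × (Fin M → β),
        -Real.log (U w.1 / (U w.1 + ∑ i, ψ w.1 (w.2 i))) ∂(ν.prod (Measure.pi fun _ => σ)) -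
          Real.log M - ∫ a, (-Real.log (U a) + Real.log (c a)) ∂ν‖ ≤
        m⁻¹ * ((M : ℝ)⁻¹ + (√M)⁻¹) := by
    filter_upwards [eventually_gt_atTop 0] with M hM
    have hM0 : (0 : ℝ) < M := by exact_mod_cast hM
    set π := Measure.pi fun _ : Fin M => σ
    set avg : α × (Fin M → β) → ℝ := fun w => (∑ i, ψ w.1 (w.2 i)) / M with havg
    have hsum_meas : Measurable fun w : α × (Fin M → β) => ∑ i, ψ w.1 (w.2 i) :=
      Finset.measurable_sum _ fun i _ =>
        hψ.comp (measurable_fst.prodMk ((measurable_pi_apply i).comp measurable_snd))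
    have havg_meas : Measurable avg := hsum_meas.div_const _
    have havgm : ∀ w, avg w ∈ Icc m 1 := fun w => by
      rw [havg, mem_Icc, le_div_iff₀ hM0, div_le_one hM0]
      constructor
      · simpa [mul_comm] using Finset.sum_le_sum fun i (_ : i ∈ Finset.univ) =>
          (hψm w.1 (w.2 i)).1
      · simpa using Finset.sum_le_sum fun i (_ : i ∈ Finset.univ) => (hψm w.1 (w.2 i)).2
    -- The denominator divided by `M`; the factor `M` taken out produces the `log M` that the
    -- normalization removes.
    set S : α × (Fin M → β) → ℝ := fun w => U w.1 / M + avg w with hS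
    have hS_meas : Measurable S := ((hU.comp measurable_fst).div_const _).add havg_meas
    have hUpos : ∀ a, 0 < U a := fun a => hm.trans_le (hUm a).1
    have hUM : ∀ a, 0 ≤ U a / M ∧ U a / M ≤ (M : ℝ)⁻¹ := fun a =>
      ⟨div_nonneg (hUpos a).le hM0.le, by
        rw [div_eq_mul_inv]
        exact mul_le_of_le_one_left (by positivity) (hUm a).2⟩
    have hSm : ∀ w, S w ∈ Icc m 2 := fun w => by
      have h1 := hUM w.1
      have h2 := havgm w
      have h3 : (M : ℝ)⁻¹ ≤ 1 := inv_le_one_of_one_le₀ (by exact_mod_cast hM)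
      exact ⟨by simp only [hS]; linarith [h2.1], by simp only [hS]; linarith [h2.2]⟩
    have hpt : ∀ w : α × (Fin M → β),
        -Real.log (U w.1 / (U w.1 + ∑ i, ψ w.1 (w.2 i))) =
          -Real.log (U w.1) + Real.log (S w) + Real.log M := by
      intro w
      have h1 : U w.1 + ∑ i, ψ w.1 (w.2 i) = S w * M := by
        simp only [hS, havg]
        field_simp
      have h2 : S w ≠ 0 := (hm.trans_le (hSm w).1).ne'
      rw [h1, Real.log_div (hUpos _).ne' (mul_ne_zero h2 hM0.ne'), Real.log_mul h2 hM0.ne']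
      ring
    have hlogU : Integrable (fun a => -Real.log (U a)) ν :=
      integrable_of_mem_Icc (a := 0) (b := -Real.log m) (by fun_prop) fun a =>
        ⟨by linarith [(hlog (hUm a)).2], by linarith [(hlog (hUm a)).1]⟩
    have hlogc : Integrable (fun a => Real.log (c a)) ν :=
      integrable_of_mem_Icc (by fun_prop) fun a => hlog (hcm a)
    have hlogS : Integrable (fun w => Real.log (S w)) (ν.prod π) :=
      integrable_of_mem_Icc (a := Real.log m) (b := Real.log 2) (by fun_prop) fun w =>
        ⟨Real.log_le_log hm (hSm w).1, Real.log_le_log (hm.trans_le (hSm w).1) (hSm w).2⟩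
    have hlogU' : Integrable (fun w : α × (Fin M → β) => -Real.log (U w.1)) (ν.prod π) :=
      hlogU.comp_fst π
    have hlogc' : Integrable (fun w : α × (Fin M → β) => Real.log (c w.1)) (ν.prod π) :=
      hlogc.comp_fst π
    have hUS : Integrable (fun w : α × (Fin M → β) => -Real.log (U w.1) + Real.log (S w))
        (ν.prod π) := hlogU'.add hlogS
    have hUc : Integrable (fun w : α × (Fin M → β) => -Real.log (U w.1) + Real.log (c w.1))
        (ν.prod π) := hlogU'.add hlogc'
    have hdiff : Integrable (fun w : α × (Fin M → β) => |avg w - c w.1|) (ν.prod π) :=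
      integrable_of_mem_Icc (a := 0) (b := 1)
        (havg_meas.sub (hcmeas.comp measurable_fst)).abs fun w =>
        ⟨abs_nonneg _, abs_sub_le_iff.2 ⟨by linarith [(havgm w).2, (hcm w.1).1],
          by linarith [(havgm w).1, (hcm w.1).2]⟩⟩
    have e1 : ∫ a, (-Real.log (U a) + Real.log (c a)) ∂ν =
        ∫ w, (-Real.log (U w.1) + Real.log (c w.1)) ∂(ν.prod π) := by
      rw [integral_fun_fst (μ := ν) (ν := π) (fun a => -Real.log (U a) + Real.log (c a))]
      simp
    have e2 : ∫ w : α × (Fin M → β),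
        -Real.log (U w.1 / (U w.1 + ∑ i, ψ w.1 (w.2 i))) ∂(ν.prod π) - Real.log M =
          ∫ w, (-Real.log (U w.1) + Real.log (S w)) ∂(ν.prod π) := by
      simp_rw [hpt]
      rw [integral_add hUS (integrable_const _)]
      simp
    rw [e1, e2, ← integral_sub hUS hUc]
    calc ‖∫ w, (-Real.log (U w.1) + Real.log (S w) - (-Real.log (U w.1) + Real.log (c w.1)))
            ∂(ν.prod π)‖
        ≤ ∫ w, m⁻¹ * ((M : ℝ)⁻¹ + |avg w - c w.1|) ∂(ν.prod π) := by
          refine norm_integral_le_of_norm_le (((integrable_const _).add hdiff).const_mul _)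
            (ae_of_all _ fun w => ?_)
          rw [add_sub_add_left_eq_sub, Real.norm_eq_abs]
          refine (Real.abs_log_sub_log_le hm (hSm w).1 (hcm w.1).1).trans ?_
          gcongr
          simp only [hS]
          rw [add_sub_assoc]
          refine (abs_add_le _ _).trans ?_
          gcongr
          rw [abs_of_nonneg (hUM w.1).1]
          exact (hUM w.1).2
      _ = m⁻¹ * ((M : ℝ)⁻¹ + ∫ w, |avg w - c w.1| ∂(ν.prod π)) := by
          rw [integral_const_mul, integral_add (integrable_const _) hdiff]
          simp
      _ ≤ m⁻¹ * ((M : ℝ)⁻¹ + (√M)⁻¹) := by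
          gcongr
          rw [integral_prod _ hdiff]
          calc ∫ a, ∫ n, |avg (a, n) - c a| ∂π ∂ν ≤ ∫ _a, (√M)⁻¹ ∂ν := by
                refine integral_mono hdiff.integral_prod_left (integrable_const _) fun a => ?_
                exact integral_abs_average_sub_le (hψa a)
                  (fun b => ⟨hm.le.trans (hψm a b).1, (hψm a b).2⟩) hM
            _ = (√M)⁻¹ := by simp
  refine squeeze_zero' (Eventually.of_forall fun _ => norm_nonneg _) hbound ?_
  have h1 : Tendsto (fun M : ℕ => (M : ℝ)⁻¹) atTop (𝓝 0) := tendsto_inv_atTop_nhds_zero_nat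
  have h2 : Tendsto (fun M : ℕ => (√(M : ℝ))⁻¹) atTop (𝓝 0) :=
    tendsto_inv_atTop_zero.comp (Real.tendsto_sqrt_atTop.comp tendsto_natCast_atTop_atTop)
  simpa using (h1.add h2).const_mul m⁻¹

end Sampling

/-! ### Gibbs' inequality. -/

/-- Gibbs' inequality for conditional densities `exp (-F) / c`, with the case of equality. -/
theorem ae_eq_of_crossEntropy_le {α β : Type*} [MeasurableSpace α] [MeasurableSpace β]
    {ρ : Measure α} [IsProbabilityMeasure ρ] {σ : Measure β} [IsProbabilityMeasure σ]
    {F₁ F₂ : α × β → ℝ} (hF₁ : Measurable F₁) (hF₂ : Measurable F₂) {K : ℝ}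
    (hF₁K : ∀ q, F₁ q ∈ Icc 0 K) (hF₂K : ∀ q, F₂ q ∈ Icc 0 K) {c₁ c₂ : α → ℝ}
    (hc₁ : ∀ a, c₁ a = ∫ b, Real.exp (-F₁ (a, b)) ∂σ)
    (hc₂ : ∀ a, c₂ a = ∫ b, Real.exp (-F₂ (a, b)) ∂σ)
    (hle : ∫ q, (F₂ q + Real.log (c₂ q.1)) ∂((ρ.prod σ).withDensity fun q =>
        ENNReal.ofReal (Real.exp (-F₁ q) / c₁ q.1)) ≤
      ∫ q, (F₁ q + Real.log (c₁ q.1)) ∂((ρ.prod σ).withDensity fun q =>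
        ENNReal.ofReal (Real.exp (-F₁ q) / c₁ q.1))) :
    ∀ᵐ q ∂(ρ.prod σ), F₁ q + Real.log (c₁ q.1) = F₂ q + Real.log (c₂ q.1) := by
  set κ := ρ.prod σ
  set m := Real.exp (-K) with hm
  have hm0 : 0 < m := Real.exp_pos _
  have main : ∀ {F : α × β → ℝ} {c : α → ℝ}, Measurable F → (∀ q, F q ∈ Icc 0 K) →
      (∀ a, c a = ∫ b, Real.exp (-F (a, b)) ∂σ) →
      Measurable c ∧ (∀ a, c a ∈ Icc m 1) ∧ ∫ q, Real.exp (-F q) / c q.1 ∂κ = 1 ∧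
        (∀ q, Real.exp (-F q) / c q.1 ∈ Icc 0 m⁻¹) ∧
        (∀ q, F q + Real.log (c q.1) ∈ Icc (-K) K) := by
    intro F c hF hFK hc
    have hE : Measurable fun q => Real.exp (-F q) := by fun_prop
    have hEm : ∀ q, Real.exp (-F q) ∈ Icc m 1 := fun q =>
      ⟨Real.exp_le_exp.2 (neg_le_neg (hFK q).2), Real.exp_le_one_iff.2 (by linarith [(hFK q).1])⟩
    have hEint : ∀ a, Integrable (fun b => Real.exp (-F (a, b))) σ := fun a =>
      integrable_of_mem_Icc (hE.comp measurable_prodMk_left) fun b => hEm (a, b)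
    have hcmeas : Measurable c := by
      rw [show c = fun a => ∫ b, Real.exp (-F (a, b)) ∂σ from funext hc]
      exact (hE.stronglyMeasurable.integral_prod_right' (ν := σ)).measurable
    have hcm : ∀ a, c a ∈ Icc m 1 := fun a => by
      rw [hc]
      exact ⟨by simpa using integral_mono (integrable_const m) (hEint a) fun b => (hEm (a, b)).1,
        by simpa using integral_mono (hEint a) (integrable_const (1 : ℝ)) fun b => (hEm (a, b)).2⟩
    have hpm : ∀ q, Real.exp (-F q) / c q.1 ∈ Icc 0 m⁻¹ := fun q => by
      have h0 := hm0.trans_le (hcm q.1).1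
      refine ⟨by positivity, ?_⟩
      rw [div_eq_mul_inv]
      calc Real.exp (-F q) * (c q.1)⁻¹ ≤ 1 * m⁻¹ := by
            gcongr
            · exact (hEm q).2
            · exact (hcm q.1).1
        _ = m⁻¹ := one_mul _
    refine ⟨hcmeas, hcm, ?_, hpm, fun q => ?_⟩
    · have hpint : Integrable (fun q => Real.exp (-F q) / c q.1) κ :=
        integrable_of_mem_Icc (hE.div (hcmeas.comp measurable_fst)) hpm
      rw [integral_prod _ hpint]
      have : ∀ a, ∫ b, Real.exp (-F (a, b)) / c a ∂σ = 1 := fun a => by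
        rw [integral_div, ← hc, div_self (hm0.trans_le (hcm a).1).ne']
      simp [this]
    · have h1 : -K ≤ Real.log (c q.1) := by
        rw [← Real.log_exp (-K)]
        exact Real.log_le_log hm0 (hcm q.1).1
      have h2 := Real.log_nonpos (hm0.le.trans (hcm q.1).1) (hcm q.1).2
      have h3 := hFK q
      exact ⟨by linarith [h3.1], by linarith [h3.2]⟩
  obtain ⟨hc₁meas, hc₁m, hp₁, hp₁m, hl₁⟩ := main hF₁ hF₁K hc₁
  obtain ⟨hc₂meas, hc₂m, hp₂, hp₂m, hl₂⟩ := main hF₂ hF₂K hc₂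
  set p₁ : α × β → ℝ := fun q => Real.exp (-F₁ q) / c₁ q.1 with hp₁def
  set p₂ : α × β → ℝ := fun q => Real.exp (-F₂ q) / c₂ q.1 with hp₂def
  set l₁ : α × β → ℝ := fun q => F₁ q + Real.log (c₁ q.1) with hl₁def
  set l₂ : α × β → ℝ := fun q => F₂ q + Real.log (c₂ q.1) with hl₂def
  have hp₁meas : Measurable p₁ := by fun_prop
  have hp₂meas : Measurable p₂ := by fun_prop
  have hl₁meas : Measurable l₁ := by fun_prop
  have hl₂meas : Measurable l₂ := by fun_prop
  have hexp₁ : ∀ q, p₁ q = Real.exp (-l₁ q) := fun q => by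
    simp only [hp₁def, hl₁def]
    rw [neg_add, Real.exp_add, Real.exp_neg (Real.log _),
      Real.exp_log (hm0.trans_le (hc₁m q.1).1), div_eq_mul_inv]
  have hexp₂ : ∀ q, p₂ q = Real.exp (-l₂ q) := fun q => by
    simp only [hp₂def, hl₂def]
    rw [neg_add, Real.exp_add, Real.exp_neg (Real.log _),
      Real.exp_log (hm0.trans_le (hc₂m q.1).1), div_eq_mul_inv]
  have hK : 0 ≤ K := by
    obtain ⟨q⟩ : Nonempty (α × β) := nonempty_of_isProbabilityMeasure κ
    exact (hF₁K q).1.trans (hF₁K q).2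
  have hpl : ∀ {l : α × β → ℝ}, Measurable l → (∀ q, l q ∈ Icc (-K) K) →
      Integrable (fun q => p₁ q * l q) κ := fun {l} hl hlK =>
    integrable_of_mem_Icc (a := -(m⁻¹ * K)) (b := m⁻¹ * K) (hp₁meas.mul hl) fun q => by
      have h1 : |p₁ q * l q| ≤ m⁻¹ * K := by
        rw [abs_mul, abs_of_nonneg (hp₁m q).1]
        exact mul_le_mul (hp₁m q).2 (abs_le.2 (hlK q)) (abs_nonneg _) (by positivity)
      exact abs_le.1 h1
  have hwd : ∀ l : α × β → ℝ, ∫ q, l q ∂(κ.withDensity fun q => ENNReal.ofReal (p₁ q)) =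
      ∫ q, p₁ q * l q ∂κ := fun l => by
    rw [integral_withDensity_eq_integral_toReal_smul (by fun_prop)
      (ae_of_all _ fun _ => ENNReal.ofReal_lt_top)]
    exact integral_congr_ae (ae_of_all _ fun q => by
      have h1 : 0 ≤ p₁ q := (hp₁m q).1
      simp only [smul_eq_mul, ENNReal.toReal_ofReal h1])
  rw [hwd l₂, hwd l₁] at hle
  have hint₁ : Integrable p₁ κ := integrable_of_mem_Icc hp₁meas hp₁m
  have hint₂ : Integrable p₂ κ := integrable_of_mem_Icc hp₂meas hp₂m
  have hlint : Integrable (fun q => p₁ q * l₂ q - p₁ q * l₁ q) κ :=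
    (hpl hl₂meas hl₂).sub (hpl hl₁meas hl₁)
  have hpint : Integrable (fun q => p₂ q - p₁ q) κ := hint₂.sub hint₁
  have hDint : Integrable (fun q => p₁ q * l₂ q - p₁ q * l₁ q + (p₂ q - p₁ q)) κ :=
    hlint.add hpint
  -- Adding `p₂ - p₁`, which integrates to zero, makes the integrand pointwise nonnegative by `t + 1
  -- ≤ exp t` with `t = l₁ - l₂`. Equality holds only at `t = 0`.
  have hD : ∀ q, p₁ q * l₂ q - p₁ q * l₁ q + (p₂ q - p₁ q) =
      p₁ q * (Real.exp (l₁ q - l₂ q) - (l₁ q - l₂ q + 1)) := fun q => by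
    have : p₂ q = p₁ q * Real.exp (l₁ q - l₂ q) := by
      rw [hexp₁, hexp₂, ← Real.exp_add]
      congr 1
      ring
    rw [this]
    ring
  have hD0 : ∀ q, 0 ≤ p₁ q * l₂ q - p₁ q * l₁ q + (p₂ q - p₁ q) := fun q => by
    rw [hD]
    exact mul_nonneg (hp₁m q).1 (sub_nonneg.2 (Real.add_one_le_exp _))
  have hDle : ∫ q, (p₁ q * l₂ q - p₁ q * l₁ q + (p₂ q - p₁ q)) ∂κ ≤ 0 := by
    rw [integral_add hlint hpint,
      integral_sub (hpl hl₂meas hl₂) (hpl hl₁meas hl₁), integral_sub hint₂ hint₁, hp₁, hp₂]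
    linarith
  have hae := (integral_eq_zero_iff_of_nonneg hD0 hDint).1
    (le_antisymm hDle (integral_nonneg hD0))
  filter_upwards [hae] with q hq
  by_contra hne
  have hne' : l₁ q - l₂ q ≠ 0 := sub_ne_zero.2 hne
  have h1 := Real.add_one_lt_exp hne'
  have h2 : 0 < p₁ q := by rw [hexp₁]; exact Real.exp_pos _
  rw [hD] at hq
  exact (mul_pos h2 (sub_pos.2 h1)).ne' hq

/-! ### The uniform law on a convex body and the law of positive pairs. -/

noncomputable section
namespace MultiView

section Uniform

variable {ι : Type*} [Fintype ι] {Z : Set (ι → ℝ)}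

theorem volume_ne_zero_of_interior (hZint : (interior Z).Nonempty) :
    (volume : Measure (ι → ℝ)) Z ≠ 0 :=
  (Measure.measure_pos_of_nonempty_interior _ hZint).ne'

theorem isProbabilityMeasure_unif (hZcomp : IsCompact Z) (hZint : (interior Z).Nonempty) :
    IsProbabilityMeasure (unif Z) :=
  ProbabilityTheory.cond_isProbabilityMeasure_of_finite (volume_ne_zero_of_interior hZint)
    hZcomp.measure_ne_top

theorem restrict_eq_smul_unif (hZcomp : IsCompact Z) (hZint : (interior Z).Nonempty) :
    volume.restrict Z = volume Z • unif Z := by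
  rw [unif, ProbabilityTheory.cond, smul_smul,
    ENNReal.mul_inv_cancel (volume_ne_zero_of_interior hZint) hZcomp.measure_ne_top, one_smul]

theorem ae_unif_mem (hZcomp : IsCompact Z) : ∀ᵐ z ∂(unif Z), z ∈ Z := by
  rw [unif, ProbabilityTheory.cond]
  exact Measure.ae_smul_measure (ae_restrict_mem hZcomp.measurableSet) _

theorem restrict_absolutelyContinuous_unif (hZcomp : IsCompact Z)
    (hZint : (interior Z).Nonempty) : volume.restrict Z ≪ unif Z := by
  rw [restrict_eq_smul_unif hZcomp hZint]
  exact Measure.smul_absolutelyContinuous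

theorem ae_unif_prod_mem (hZcomp : IsCompact Z) (hZint : (interior Z).Nonempty) :
    ∀ᵐ q ∂((unif Z).prod (unif Z)), q.1 ∈ Z ∧ q.2 ∈ Z := by
  have := isProbabilityMeasure_unif hZcomp hZint
  exact (Measure.quasiMeasurePreserving_fst.ae (ae_unif_mem hZcomp)).and
    (Measure.quasiMeasurePreserving_snd.ae (ae_unif_mem hZcomp))

/-- The interior is dense in a convex body, and null sets of the uniform law are Lebesgue null in
`Z`, so continuity removes the exceptional set. -/
theorem eqOn_of_ae_unif {f g : (ι → ℝ) → ℝ} (hZconv : Convex ℝ Z) (hZcomp : IsCompact Z)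
    (hZint : (interior Z).Nonempty) (hf : ContinuousOn f Z) (hg : ContinuousOn g Z)
    (h : f =ᵐ[unif Z] g) : EqOn f g Z :=
  Measure.eqOn_of_ae_eq (μ := volume)
    ((restrict_absolutelyContinuous_unif hZcomp hZint).ae_eq h) hf hg
    (hZconv.subset_closure_interior hZint)

theorem eqOn_of_ae_unif_prod {f g : (ι → ℝ) × (ι → ℝ) → ℝ} (hZconv : Convex ℝ Z)
    (hZcomp : IsCompact Z) (hZint : (interior Z).Nonempty) (hf : Continuous f) (hg : Continuous g)
    (h : f =ᵐ[(unif Z).prod (unif Z)] g) : EqOn f g (Z ×ˢ Z) := by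
  have := isProbabilityMeasure_unif hZcomp hZint
  have hac := restrict_absolutelyContinuous_unif hZcomp hZint
  have h1 := (hac.prod hac).ae_eq h
  rw [Measure.prod_restrict] at h1
  refine Measure.eqOn_of_ae_eq h1 hf.continuousOn hg.continuousOn ?_
  rw [interior_prod_eq, closure_prod_eq]
  exact prod_mono (hZconv.subset_closure_interior hZint)
    (hZconv.subset_closure_interior hZint)

/-- Passing from Lebesgue measure to the uniform law multiplies the reference measure by the volume
of `Z` and divides the density by it, since `partitionFn` contains the same factor. The result has
the form required by `ae_eq_of_crossEntropy_le`. -/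
theorem positiveLaw_eq (N : Seminorm ℝ (ι → ℝ)) (hZcomp : IsCompact Z)
    (hZint : (interior Z).Nonempty) {F : (ι → ℝ) × (ι → ℝ) → ℝ} (hF : Measurable F)
    (hFN : ∀ q ∈ Z ×ˢ Z, F q = N (q.1 - q.2)) :
    positiveLaw N Z = ((unif Z).prod (unif Z)).withDensity fun q =>
      ENNReal.ofReal (Real.exp (-F q) / ∫ b, Real.exp (-F (q.1, b)) ∂(unif Z)) := by
  have := isProbabilityMeasure_unif hZcomp hZint
  have hvol : (volume : Measure (ι → ℝ)) Z ≠ 0 := volume_ne_zero_of_interior hZint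
  have hvol' : (volume : Measure (ι → ℝ)) Z ≠ ⊤ := hZcomp.measure_ne_top
  have hE : Measurable fun q => Real.exp (-F q) := by fun_prop
  have hcmeas : Measurable fun a => ∫ b, Real.exp (-F (a, b)) ∂(unif Z) :=
    (hE.stronglyMeasurable.integral_prod_right' (ν := unif Z)).measurable
  have hpart : ∀ z ∈ Z, partitionFn N Z z =
      (volume : Measure (ι → ℝ)).real Z * ∫ b, Real.exp (-F (z, b)) ∂(unif Z) := by
    intro z hz
    have h1 : ∫ b, Real.exp (-F (z, b)) ∂(unif Z) = ∫ b, Real.exp (-N (z - b)) ∂(unif Z) := by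
      refine integral_congr_ae ?_
      filter_upwards [ae_unif_mem hZcomp] with b hb
      rw [hFN (z, b) ⟨hz, hb⟩]
    rw [h1, partitionFn, restrict_eq_smul_unif hZcomp hZint, integral_smul_measure]
    rfl
  have hcongr : (fun q : (ι → ℝ) × (ι → ℝ) =>
      ENNReal.ofReal ((partitionFn N Z q.1)⁻¹ * Real.exp (-N (q.1 - q.2)))) =ᵐ[(unif Z).prod (unif Z)]
      fun q => ENNReal.ofReal (((volume : Measure (ι → ℝ)).real Z)⁻¹ *
        (Real.exp (-F q) / ∫ b, Real.exp (-F (q.1, b)) ∂(unif Z))) := by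
    filter_upwards [ae_unif_prod_mem hZcomp hZint] with q hq
    rw [hpart q.1 hq.1, hFN q hq, mul_inv, div_eq_mul_inv]
    ring_nf
  have hmeas : Measurable fun q : (ι → ℝ) × (ι → ℝ) =>
      ENNReal.ofReal (((volume : Measure (ι → ℝ)).real Z)⁻¹ *
        (Real.exp (-F q) / ∫ b, Real.exp (-F (q.1, b)) ∂(unif Z))) :=
    ((hE.div (hcmeas.comp measurable_fst)).const_mul _).ennreal_ofReal
  rw [positiveLaw, restrict_eq_smul_unif hZcomp hZint, Measure.prod_smul_right,
    withDensity_smul_measure, withDensity_congr_ae hcongr, ← withDensity_smul _ hmeas]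
  congr 1
  ext q
  have hpos : 0 < (volume : Measure (ι → ℝ)).real Z := ENNReal.toReal_pos hvol hvol'
  rw [Pi.smul_apply, smul_eq_mul, ENNReal.ofReal_mul (by positivity), ENNReal.ofReal_inv_of_pos hpos,
    Measure.real, ENNReal.ofReal_toReal hvol', ENNReal.mul_inv_cancel_left hvol hvol']

theorem continuous_integral_exp_neg {F : (ι → ℝ) × (ι → ℝ) → ℝ} (hF : Continuous F)
    (hF0 : ∀ q, 0 ≤ F q) (σ : Measure (ι → ℝ)) [IsFiniteMeasure σ] :
    Continuous fun a => ∫ b, Real.exp (-F (a, b)) ∂σ := by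
  refine continuous_of_dominated (bound := fun _ => 1) (fun a => ?_) (fun a => ?_)
    (integrable_const _) (ae_of_all _ fun b => by fun_prop)
  · exact (by fun_prop : Continuous fun b => Real.exp (-F (a, b))).aestronglyMeasurable
  · exact ae_of_all _ fun b => by
      rw [Real.norm_of_nonneg (Real.exp_pos _).le]
      exact Real.exp_le_one_iff.2 (neg_nonpos.2 (hF0 _))

theorem _root_.Seminorm.continuous_of_fintype (N : Seminorm ℝ (ι → ℝ)) : Continuous N := by
  have h := N.convexOn.continuousOn isOpen_univ
  rwa [continuousOn_univ] at h

/-- The distance between values of a map which is continuous on a compact set, extended to a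
bounded continuous function. -/
theorem exists_continuous_distance (N : Seminorm ℝ (ι → ℝ)) (hZcomp : IsCompact Z)
    {h : (ι → ℝ) → ι → ℝ} (hh : ContinuousOn h Z) {μ : ℝ} (hμ : 0 < μ) :
    ∃ (K : ℝ) (F : (ι → ℝ) × (ι → ℝ) → ℝ), Continuous F ∧ (∀ q, F q ∈ Icc 0 K) ∧
      ∀ q ∈ Z ×ˢ Z, F q = N (h q.1 - h q.2) / μ := by
  set f : (ι → ℝ) × (ι → ℝ) → ℝ := fun q => N (h q.1 - h q.2) / μ with hfdef
  have hf : ContinuousOn f (Z ×ˢ Z) := by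
    refine ContinuousOn.div_const (N.continuous_of_fintype.comp_continuousOn ?_) _
    exact (hh.comp continuousOn_fst fun q hq => hq.1).sub
      (hh.comp continuousOn_snd fun q hq => hq.2)
  have hcomp := hZcomp.prod hZcomp
  obtain ⟨K, hK⟩ := hcomp.bddAbove_image hf
  -- Tietze extension: `h` is controlled only on `Z`, while the limit theorems need global
  -- measurability and bounds. The clamping below does not change values on `Z ×ˢ Z`.
  obtain ⟨G, hG⟩ := ContinuousMap.exists_restrict_eq hcomp.isClosed
    ⟨(Z ×ˢ Z).domRestrict f, hf.domRestrict⟩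
  have hGf : ∀ q ∈ Z ×ˢ Z, G q = f q := fun q hq => congrArg (fun φ => φ ⟨q, hq⟩) hG
  refine ⟨max K 0, fun q => max 0 (min (G q) (max K 0)), by fun_prop, fun q =>
    ⟨le_max_left _ _, max_le (le_max_right _ _) (min_le_right _ _)⟩, fun q hq => ?_⟩
  have h0 : 0 ≤ f q := div_nonneg (apply_nonneg N _) hμ.le
  have h1 : f q ≤ max K 0 := (hK (mem_image_of_mem f hq)).trans (le_max_left _ _)
  simp only [hGf q hq, min_eq_left h1, max_eq_right h0]
  rfl

end Uniform

variable {V dc L : ℕ} {p D : Fin V → ℕ}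

theorem continuous_viewSource (v : Fin V) :
    Continuous (viewSource v : Latent dc p → ViewIdx dc (p v) → ℝ) := by
  refine continuous_pi fun i => ?_
  cases i <;> simp only [viewSource, Sum.elim_inl, Sum.elim_inr] <;> fun_prop

theorem continuous_transition {ι : Type*} [Fintype ι] (A : Fin L → Matrix ι ι ℝ) :
    Continuous (transition A) := by
  unfold transition
  fun_prop

theorem transition_smul {ι : Type*} [Fintype ι] (A : Fin L → Matrix ι ι ℝ) (c : ℝ)
    (z : Fin L → ι → ℝ) : transition A (fun τ => c • z τ) = c • transition A z := by
  simp [transition, Matrix.mulVec_smul, Finset.smul_sum]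

/-! ### Admissible models: continuity, limit objective, vanishing merge loss. -/

section Model

variable {N : Seminorm ℝ (Latent dc p)} {Z W : Set (Latent dc p)}
  {g : ∀ v, (ViewIdx dc (p v) → ℝ) → EuclideanSpace ℝ (Fin (D v))}
  {A : Fin L → Matrix (FullIdx dc p) (FullIdx dc p) ℝ}
  {P : Measure (Latent dc p × (Fin L → Latent dc p))} {μ η β : ℝ} {θ : Model dc p D L}

theorem Admissible.continuousOn_sorted (hgcont : ∀ v, ContinuousOn (g v) (viewSpace Z v))
    (hθ : Admissible Z W g A P θ) (v : Fin V) : ContinuousOn (θ.sorted g v) Z := by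
  have h1 : ContinuousOn (θ.est g v) Z :=
    (hθ.continuousOn v).comp ((hgcont v).comp (continuous_viewSource v).continuousOn
      (mapsTo_image _ _)) fun z hz => mem_image_of_mem _ (mem_image_of_mem _ hz)
  exact (by fun_prop : Continuous fun x => (θ.B v).mulVec x).comp_continuousOn h1

theorem Admissible.continuousOn_sorted_apply (hgcont : ∀ v, ContinuousOn (g v) (viewSpace Z v))
    (hθ : Admissible Z W g A P θ) (v : Fin V) (i : ViewIdx dc (p v)) :
    ContinuousOn (fun z => θ.sorted g v z i) Z :=
  (continuous_apply i).comp_continuousOn (hθ.continuousOn_sorted hgcont v)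

theorem Admissible.continuousOn_center (hgcont : ∀ v, ContinuousOn (g v) (viewSpace Z v))
    (hθ : Admissible Z W g A P θ) (i : Fin dc) : ContinuousOn (fun z => θ.center g z i) Z :=
  (continuousOn_finsetSum _ fun v _ => hθ.continuousOn_sorted_apply hgcont v _).div_const _

theorem Admissible.continuousOn_h (hgcont : ∀ v, ContinuousOn (g v) (viewSpace Z v))
    (hθ : Admissible Z W g A P θ) : ContinuousOn (θ.h g) Z := by
  refine continuousOn_pi.2 fun i => ?_
  rcases i with i | ⟨v, j⟩
  · exact hθ.continuousOn_center hgcont i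
  · exact hθ.continuousOn_sorted_apply hgcont v _

/-- Almost surely all sources lie in `Z` and the prediction equals `h` of the transited source, so
every distance in the loss is a value of `F`. The limit then depends on `P` only through the law of
the pair `(z, z̃)`. -/
theorem Admissible.tendsto_contrastiveLoss [IsProbabilityMeasure P]
    (hZcomp : IsCompact Z) (hZint : (interior Z).Nonempty)
    (hPmem : ∀ᵐ q ∂P, q.1 ∈ Z ∧ transition A q.2 ∈ Z)
    (hPlaw : P.map (fun q => (q.1, transition A q.2)) = positiveLaw N Z)
    (hθ : Admissible Z W g A P θ) {K : ℝ} {F : Latent dc p × Latent dc p → ℝ} (hF : Continuous F)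
    (hFK : ∀ q, F q ∈ Icc 0 K)
    (hFh : ∀ q ∈ Z ×ˢ Z, F q = N (θ.h g q.1 - θ.h g q.2) / μ) :
    Tendsto (fun M : ℕ => contrastiveLoss N Z g P μ M θ - Real.log M) atTop
      (𝓝 (∫ q, (F q + Real.log (∫ b, Real.exp (-F (q.1, b)) ∂(unif Z))) ∂(positiveLaw N Z))) := by
  have := isProbabilityMeasure_unif hZcomp hZint
  have hF0 : ∀ q, 0 ≤ F q := fun q => (hFK q).1
  have hmeasP : Measurable fun q : Latent dc p × (Fin L → Latent dc p) =>
      (q.1, transition A q.2) :=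
    measurable_fst.prodMk ((continuous_transition A).measurable.comp measurable_snd)
  have hexp : ∀ q, Real.exp (-F q) ∈ Icc (Real.exp (-K)) 1 := fun q =>
    ⟨Real.exp_le_exp.2 (neg_le_neg (hFK q).2), Real.exp_le_one_iff.2 (neg_nonpos.2 (hF0 q))⟩
  have hlim := tendsto_integral_contrastive (ν := P) (σ := unif Z)
    (U := fun q => Real.exp (-F (q.1, transition A q.2)))
    (ψ := fun q b => Real.exp (-F (q.1, b)))
    (Real.measurable_exp.comp (hF.measurable.comp hmeasP).neg)
    (Real.measurable_exp.comp (hF.measurable.comp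
      ((measurable_fst.comp measurable_fst).prodMk measurable_snd)).neg)
    (Real.exp_pos (-K)) (fun _ => hexp _) (fun _ _ => hexp _)
  have hcont : Continuous fun q : Latent dc p × Latent dc p =>
      F q + Real.log (∫ b, Real.exp (-F (q.1, b)) ∂(unif Z)) := by
    refine hF.add (Continuous.log ((continuous_integral_exp_neg hF hF0 _).comp continuous_fst)
      fun q => ?_)
    refine (integral_exp_pos ?_).ne'
    exact integrable_of_mem_Icc (by fun_prop) fun b => hexp (q.1, b)
  rw [← hPlaw, integral_map hmeasP.aemeasurable hcont.aestronglyMeasurable]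
  simp only [Real.log_exp, neg_neg] at hlim
  refine hlim.congr fun M => ?_
  congr 1
  refine integral_congr_ae ?_
  have hpi : ∀ᵐ n ∂(Measure.pi fun _ : Fin M => unif Z), ∀ i, n i ∈ Z :=
    ae_all_iff.2 fun i => (Measure.quasiMeasurePreserving_eval (fun _ : Fin M => unif Z) i).ae
      (ae_unif_mem hZcomp)
  filter_upwards [Measure.quasiMeasurePreserving_fst.ae (hPmem.and hθ.transition_eq),
    Measure.quasiMeasurePreserving_snd.ae hpi] with w hw hn
  obtain ⟨⟨hw1, hw2⟩, hw3⟩ := hw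
  rw [hw3, neg_div, ← hFh (w.1.1, transition A w.1.2) ⟨hw1, hw2⟩]
  have : ∀ i, -N (θ.h g w.1.1 - θ.h g (w.2 i)) / μ = -F (w.1.1, w.2 i) := fun i => by
    rw [neg_div, ← hFh (w.1.1, w.2 i) ⟨hw1, hn i⟩]
  simp only [this]

theorem entropy_nonneg {ι : Type*} [Fintype ι] [DecidableEq ι] {B : Matrix ι ι ℝ}
    (hB : B ∈ doublyStochastic ℝ ι) : 0 ≤ entropy B :=
  Finset.sum_nonneg fun _ _ => Finset.sum_nonneg fun _ _ =>
    Real.negMulLog_nonneg (nonneg_of_mem_doublyStochastic hB) (le_one_of_mem_doublyStochastic hB)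

theorem entropy_one {ι : Type*} [Fintype ι] [DecidableEq ι] :
    entropy (1 : Matrix ι ι ℝ) = 0 :=
  Finset.sum_eq_zero fun i _ => Finset.sum_eq_zero fun j _ => by
    rw [Matrix.one_apply]
    split_ifs <;> simp

/-- Every entropy summand is nonnegative, hence zero, so the entries are `0` or `1`. Row sums then
single out one column per row, and column sums make this choice injective. -/
theorem exists_permMatrix_of_entropy_eq_zero {ι : Type*} [Fintype ι] [DecidableEq ι]
    {B : Matrix ι ι ℝ} (hB : B ∈ doublyStochastic ℝ ι) (h : entropy B = 0) :
    ∃ σ : Equiv.Perm ι, B = σ.permMatrix ℝ := by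
  have h0 : ∀ i j, 0 ≤ B i j := fun i j => nonneg_of_mem_doublyStochastic hB
  have hneg : ∀ i j, 0 ≤ Real.negMulLog (B i j) := fun i j =>
    Real.negMulLog_nonneg (h0 i j) (le_one_of_mem_doublyStochastic hB)
  have h01 : ∀ i j, B i j = 0 ∨ B i j = 1 := by
    intro i j
    have h1 := (Finset.sum_eq_zero_iff_of_nonneg fun i _ =>
      Finset.sum_nonneg fun j _ => hneg i j).1 h i (Finset.mem_univ _)
    have h2 := (Finset.sum_eq_zero_iff_of_nonneg fun j _ => hneg i j).1 h1 j (Finset.mem_univ _)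
    rw [Real.negMulLog, mul_eq_zero, neg_eq_zero, Real.log_eq_zero] at h2
    have := h0 i j
    -- `Real.log` vanishes at `0`, `1` and `-1`; nonnegativity excludes the last value.
    rcases h2 with h2 | h2 | h2 | h2
    · exact Or.inl h2
    · exact Or.inl h2
    · exact Or.inr h2
    · linarith
  have hex : ∀ i, ∃ j, B i j = 1 := by
    intro i
    by_contra! hne
    have := sum_row_of_mem_doublyStochastic hB i
    rw [Finset.sum_eq_zero fun j _ => (h01 i j).resolve_right (hne j)] at this
    exact zero_ne_one this
  choose σ hσ using hex
  have hrow : ∀ i j, j ≠ σ i → B i j = 0 := by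
    intro i j hj
    by_contra hne
    have h1 := (h01 i j).resolve_left hne
    have h2 := sum_row_of_mem_doublyStochastic hB i
    have h3 : ∑ k ∈ {j, σ i}, B i k ≤ ∑ k, B i k :=
      Finset.sum_le_sum_of_subset_of_nonneg (Finset.subset_univ _) fun k _ _ => h0 i k
    rw [Finset.sum_pair hj, h1, hσ, h2] at h3
    norm_num at h3
  have hinj : Function.Injective σ := by
    intro i i' hii'
    by_contra hne
    have h2 := sum_col_of_mem_doublyStochastic hB (σ i)
    have h3 : ∑ k ∈ {i, i'}, B k (σ i) ≤ ∑ k, B k (σ i) :=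
      Finset.sum_le_sum_of_subset_of_nonneg (Finset.subset_univ _) fun k _ _ => h0 k _
    rw [Finset.sum_pair hne, hσ, hii', hσ, ← hii', h2] at h3
    norm_num at h3
  refine ⟨Equiv.ofBijective σ (Finite.injective_iff_bijective.1 hinj), ?_⟩
  ext i j
  simp only [Equiv.Perm.permMatrix, Equiv.toPEquiv, PEquiv.toMatrix_apply]
  by_cases hj : j = σ i
  · subst hj
    simp [hσ]
  · simp [hrow i j hj, Ne.symm hj]

theorem mergeCost_nonneg (v : Fin V) :
    0 ≤ ∫ z, ∑ i, (θ.sorted g v z (Sum.inl i) - θ.center g z i) ^ 2 ∂(unif Z) :=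
  integral_nonneg fun _ => Finset.sum_nonneg fun _ _ => sq_nonneg _

theorem Admissible.mergeLoss_nonneg (hθ : Admissible Z W g A P θ) (hη : 0 < η) :
    0 ≤ mergeLoss Z g η θ :=
  Finset.sum_nonneg fun v _ => add_nonneg (mergeCost_nonneg v)
    (mul_nonneg hη.le (entropy_nonneg (hθ.doublyStochastic v)))

/-- The loss is a sum of nonnegative terms, so each vanishes. The transport cost is the integral of
a continuous nonnegative function, which is therefore zero on all of `Z`. -/
theorem Admissible.aligned_of_mergeLoss_eq_zero (hZconv : Convex ℝ Z) (hZcomp : IsCompact Z)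
    (hZint : (interior Z).Nonempty) (hgcont : ∀ v, ContinuousOn (g v) (viewSpace Z v))
    (hθ : Admissible Z W g A P θ) (hη : 0 < η) (h : mergeLoss Z g η θ = 0) (v : Fin V) :
    entropy (θ.B v) = 0 ∧ ∀ z ∈ Z, ∀ i, θ.sorted g v z (Sum.inl i) = θ.center g z i := by
  have := isProbabilityMeasure_unif hZcomp hZint
  have hent := entropy_nonneg (hθ.doublyStochastic v)
  have hcost := mergeCost_nonneg (Z := Z) (g := g) (θ := θ) v
  have hsum := (Finset.sum_eq_zero_iff_of_nonneg fun v _ => add_nonneg (mergeCost_nonneg v)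
    (mul_nonneg hη.le (entropy_nonneg (hθ.doublyStochastic v)))).1 h v (Finset.mem_univ _)
  have hent0 : η * entropy (θ.B v) = 0 :=
    le_antisymm (by linarith) (mul_nonneg hη.le hent)
  refine ⟨(mul_eq_zero.1 hent0).resolve_left hη.ne', fun z hz i => ?_⟩
  have hcont : ContinuousOn
      (fun z => ∑ i, (θ.sorted g v z (Sum.inl i) - θ.center g z i) ^ 2) Z :=
    continuousOn_finsetSum _ fun i _ => ((hθ.continuousOn_sorted_apply hgcont v _).sub
      (hθ.continuousOn_center hgcont i)).pow 2
  have hint : Integrable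
      (fun z => ∑ i, (θ.sorted g v z (Sum.inl i) - θ.center g z i) ^ 2) (unif Z) :=
    (hcont.integrableOn_compact hZcomp).smul_measure
      (ENNReal.inv_ne_top.2 (volume_ne_zero_of_interior hZint))
  have hae := (integral_eq_zero_iff_of_nonneg
    (fun z => Finset.sum_nonneg fun i _ => sq_nonneg _) hint).1 (by linarith)
  have hz0 := eqOn_of_ae_unif hZconv hZcomp hZint hcont continuousOn_const hae hz
  have := (Finset.sum_eq_zero_iff_of_nonneg fun i _ => sq_nonneg _).1 hz0 i (Finset.mem_univ _)
  exact sub_eq_zero.1 (pow_eq_zero_iff two_ne_zero |>.1 this)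

end Model

/-! ### The comparison model, which attains both lower bounds. -/

section Reference

variable {N : Seminorm ℝ (Latent dc p)} {Z W : Set (Latent dc p)}
  {g : ∀ v, (ViewIdx dc (p v) → ℝ) → EuclideanSpace ℝ (Fin (D v))}
  {A : Fin L → Matrix (FullIdx dc p) (FullIdx dc p) ℝ}
  {P : Measure (Latent dc p × (Fin L → Latent dc p))} {μ : ℝ}

/-- The model which inverts the mixing maps, up to the factor `μ`. -/
def inverseModel (Z : Set (Latent dc p))
    (g : ∀ v, (ViewIdx dc (p v) → ℝ) → EuclideanSpace ℝ (Fin (D v)))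
    (A : Fin L → Matrix (FullIdx dc p) (FullIdx dc p) ℝ) (μ : ℝ) : Model dc p D L where
  r v x := μ • Function.invFunOn (g v) (viewSpace Z v) x
  B _ := 1
  A := A

/-- A continuous injection of a compact space into a Hausdorff space is a closed embedding. This
makes the inverse of each mixing map an allowed encoder. -/
theorem _root_.IsCompact.continuousOn_invFunOn {X Y : Type*} [Nonempty X] [TopologicalSpace X]
    [TopologicalSpace Y] [T2Space Y] {f : X → Y} {s : Set X} (hs : IsCompact s)
    (hf : ContinuousOn f s) (hinj : InjOn f s) :
    ContinuousOn (Function.invFunOn f s) (f '' s) := by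
  have : CompactSpace s := isCompact_iff_compactSpace.1 hs
  have hemb : IsClosedEmbedding (s.domRestrict f) :=
    hf.domRestrict.isClosedEmbedding hinj.injective
  rw [continuousOn_iff_continuous_domRestrict]
  have hmem : ∀ y : f '' s, Function.invFunOn f s y ∈ s := fun y => Function.invFunOn_mem y.2
  have h1 : Continuous fun y : f '' s => (⟨Function.invFunOn f s y, hmem y⟩ : s) := by
    rw [hemb.isInducing.continuous_iff]
    convert continuous_subtype_val (p := fun y => y ∈ f '' s) using 1
    ext y
    exact Function.invFunOn_eq y.2
  exact continuous_subtype_val.comp h1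

theorem inverseModel_sorted (hginj : ∀ v, InjOn (g v) (viewSpace Z v)) {z : Latent dc p}
    (hz : z ∈ Z) (v : Fin V) : (inverseModel Z g A μ).sorted g v z = μ • viewSource v z := by
  simp only [Model.sorted, Model.est, inverseModel, Matrix.one_mulVec]
  rw [(hginj v).leftInvOn_invFunOn (mem_image_of_mem _ hz)]

theorem inverseModel_center (hV : 0 < V) (hginj : ∀ v, InjOn (g v) (viewSpace Z v))
    {z : Latent dc p} (hz : z ∈ Z) (i : Fin dc) :
    (inverseModel Z g A μ).center g z i = μ * z (Sum.inl i) := by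
  have hV' : (V : ℝ) ≠ 0 := by positivity
  simp only [Model.center, inverseModel_sorted hginj hz]
  simp [viewSource]
  field_simp

theorem inverseModel_h (hV : 0 < V) (hginj : ∀ v, InjOn (g v) (viewSpace Z v))
    {z : Latent dc p} (hz : z ∈ Z) : (inverseModel Z g A μ).h g z = μ • z := by
  ext (i | ⟨v, j⟩)
  · simpa [Model.h] using inverseModel_center hV hginj hz i
  · simp [Model.h, inverseModel_sorted hginj hz, viewSource]

/-- On `Z` this model has `h z = μ • z`, which commutes with the linear transition, so the true
matrices `A` can be kept. -/
theorem admissible_inverseModel (hV : 0 < V) (hZcomp : IsCompact Z)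
    (hgcont : ∀ v, ContinuousOn (g v) (viewSpace Z v))
    (hginj : ∀ v, InjOn (g v) (viewSpace Z v)) (hA : ∀ τ, IsUnit (A τ).det)
    (hPmem : ∀ᵐ q ∂P, ∀ τ, q.2 τ ∈ Z) (hPmem' : ∀ᵐ q ∂P, transition A q.2 ∈ Z)
    (hW : ∀ z ∈ Z, μ • z ∈ W) : Admissible Z W g A P (inverseModel Z g A μ) where
  continuousOn v := ((hZcomp.image (continuous_viewSource v)).continuousOn_invFunOn (hgcont v)
    (hginj v)).const_smul μ
  doublyStochastic _ := one_mem _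
  fullRank := hA
  mapsTo z hz := by
    rw [inverseModel_h hV hginj hz]
    exact hW z hz
  transition_eq := by
    filter_upwards [hPmem, hPmem'] with q hq hq'
    rw [inverseModel_h hV hginj hq']
    simp only [inverseModel_h hV hginj (hq _)]
    exact transition_smul A μ q.2

theorem mergeLoss_inverseModel (hV : 0 < V) (hZcomp : IsCompact Z)
    (hginj : ∀ v, InjOn (g v) (viewSpace Z v)) (η : ℝ) :
    mergeLoss Z g η (inverseModel Z g A μ) = 0 := by
  refine Finset.sum_eq_zero fun v _ => ?_
  have h1 : entropy ((inverseModel Z g A μ).B v) = 0 := entropy_one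
  rw [h1, mul_zero, add_zero]
  refine integral_eq_zero_of_ae ?_
  filter_upwards [ae_unif_mem hZcomp] with z hz
  simp [inverseModel_sorted hginj hz, inverseModel_center hV hginj hz, viewSource]

end Reference

/-! ### Linear algebra of common and private components. -/

/-- The common part of a latent vector. -/
def commonPart : Latent dc p →ₗ[ℝ] (Fin dc → ℝ) := LinearMap.funLeft ℝ ℝ Sum.inl

/-- The latent vector with a given common part and vanishing private parts. -/
def ofCommon : (Fin dc → ℝ) →ₗ[ℝ] Latent dc p where
  toFun c := Sum.elim c 0
  map_add' c c' := by ext (i | j) <;> simp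
  map_smul' a c := by ext (i | j) <;> simp

theorem commonPart_ofCommon (c : Fin dc → ℝ) : commonPart (ofCommon (p := p) c) = c := rfl

/-- If a linear bijection sends vectors with vanishing source of one view to vectors with vanishing
common part, and there are two views, then it identifies the common parts. -/
theorem commonPart_eq_zero_iff_of_viewSource (hV : 2 ≤ V) {T : Latent dc p →ₗ[ℝ] Latent dc p}
    (hT : Function.Injective T)
    (hview : ∀ v x, viewSource v x = 0 → commonPart (T x) = 0) (x : Latent dc p) :
    commonPart (T x) = 0 ↔ commonPart x = 0 := by
  have hpriv : ∀ x : Latent dc p, commonPart x = 0 → commonPart (T x) = 0 := by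
    intro x hx
    let v₀ : Fin V := ⟨0, by omega⟩
    let v₁ : Fin V := ⟨1, by omega⟩
    -- A purely private vector is split into the private part of `v₀`, invisible in view `v₁`, and
    -- the remaining private parts, invisible in view `v₀`. This is where a second view is needed.
    let x₁ : Latent dc p := Sum.elim 0 fun vj => if vj.1 = v₀ then x (Sum.inr vj) else 0
    let x₂ : Latent dc p := Sum.elim 0 fun vj => if vj.1 = v₀ then 0 else x (Sum.inr vj)
    have hx12 : x = x₁ + x₂ := by
      ext (i | vj)
      · have : x (Sum.inl i) = 0 := congrFun hx i
        simpa [x₁, x₂] using this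
      · by_cases h : vj.1 = v₀ <;> simp [x₁, x₂, h]
    have h1 : viewSource v₁ x₁ = 0 := by
      ext (i | j) <;> simp [viewSource, x₁, v₁, v₀]
    have h2 : viewSource v₀ x₂ = 0 := by
      ext (i | j) <;> simp [viewSource, x₂]
    rw [hx12, map_add, map_add, hview _ _ h1, hview _ _ h2, add_zero]
  -- Private directions do not contribute, so `T` descends to an endomorphism of the common space.
  -- It inherits surjectivity from `T`, and finite dimension makes it injective.
  have hfac : ∀ x, commonPart (T x) = (commonPart ∘ₗ T ∘ₗ ofCommon) (commonPart x) := by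
    intro x
    have := hpriv (x - ofCommon (commonPart x)) (by
      rw [map_sub, commonPart_ofCommon, sub_self])
    rw [map_sub, map_sub, sub_eq_zero] at this
    exact this
  have hsurj : Function.Surjective (commonPart ∘ₗ T ∘ₗ (ofCommon (p := p))) := by
    intro c
    obtain ⟨x, hx⟩ := LinearMap.injective_iff_surjective.1 hT (ofCommon c)
    exact ⟨commonPart x, by rw [← hfac, hx, commonPart_ofCommon]⟩
  have hinj := LinearMap.injective_iff_surjective.2 hsurj
  rw [hfac, map_eq_zero_iff _ hinj]

/-- Every direction is realized, up to scale, by a displacement from `w` inside `Z`; this lets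
properties of `h` on `Z` be read as properties of its linear part on the whole space. -/
theorem exists_pos_add_smul_mem {E : Type*} [NormedAddCommGroup E] [NormedSpace ℝ E] {Z : Set E}
    {w : E} (hw : w ∈ interior Z) (x : E) : ∃ t : ℝ, 0 < t ∧ w + t • x ∈ Z := by
  have h1 : Tendsto (fun t : ℝ => w + t • x) (𝓝[>] 0) (𝓝 w) := by
    have : Continuous fun t : ℝ => w + t • x := by fun_prop
    simpa using (this.tendsto 0).mono_left nhdsWithin_le_nhds
  have h2 := h1.eventually (mem_interior_iff_mem_nhds.1 hw)
  obtain ⟨t, ht, ht'⟩ := (h2.and self_mem_nhdsWithin).exists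
  exact ⟨t, ht', ht⟩

end MultiView

end

/-! ### The identifiability theorem. -/

theorem theorem2 {V dc L : ℕ} (hV : 2 ≤ V) (hdc : 0 < dc) {p D : Fin V → ℕ}
    -- the metric `δ(x, y) = N (x - y)`, induced by a norm
    (N : Seminorm ℝ (MultiView.Latent dc p)) (hN : ∀ x, N x = 0 → x = 0)
    -- the latent space, a convex body
    (Z : Set (MultiView.Latent dc p)) (hZconv : Convex ℝ Z) (hZcomp : IsCompact Z)
    (hZint : (interior Z).Nonempty)
    -- the mixing maps of the views
    (g : ∀ v, (MultiView.ViewIdx dc (p v) → ℝ) → EuclideanSpace ℝ (Fin (D v)))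
    (hgcont : ∀ v, ContinuousOn (g v) (MultiView.viewSpace Z v))
    (hginj : ∀ v, InjOn (g v) (MultiView.viewSpace Z v))
    -- the true transition, and the law of the present source and its predecessors
    (A : Fin L → Matrix (MultiView.FullIdx dc p) (MultiView.FullIdx dc p) ℝ)
    (hA : ∀ τ, IsUnit (A τ).det)
    (P : Measure (MultiView.Latent dc p × (Fin L → MultiView.Latent dc p)))
    [IsProbabilityMeasure P]
    (hPmem : ∀ᵐ q ∂P, ∀ τ, q.2 τ ∈ Z)
    (hPlaw : P.map (fun q => (q.1, MultiView.transition A q.2)) = MultiView.positiveLaw N Z)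
    -- temperature, entropy weight, weight of the merge loss, region of the estimates
    (μ η β : ℝ) (hμ : 0 < μ) (hη : 0 < η) (hβ : 0 < β)
    (W : Set (MultiView.Latent dc p)) (hW : ∀ z ∈ Z, μ • z ∈ W)
    (θ : MultiView.Model dc p D L)
    (hθ : MultiView.IsMinimizer N Z W g A P μ η β θ) :
    (∀ z ∈ Z, ∀ z' ∈ Z, N (θ.h g z - θ.h g z') = μ * N (z - z')) ∧
    (∃ σ : ∀ v, Equiv.Perm (MultiView.ViewIdx dc (p v)),
      (∀ v, θ.B v = (σ v).permMatrix ℝ) ∧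
      ∀ z ∈ Z, ∀ v i, θ.est g v z (σ v (Sum.inl i)) = θ.center g z i) ∧
    (∀ z ∈ Z, ∀ z' ∈ Z,
      (∀ i, θ.center g z i = θ.center g z' i) ↔ ∀ i, z (Sum.inl i) = z' (Sum.inl i)) := by
  open MultiView in
  have := isProbabilityMeasure_unif hZcomp hZint
  obtain ⟨hadm, ℓ, hℓ, hmin⟩ := hθ
  have hV0 : 0 < V := by omega
  obtain ⟨K₁, F₁, hF₁, hF₁K, hF₁N⟩ := exists_continuous_distance N hZcomp
    (h := id) continuousOn_id one_pos
  simp only [id, div_one] at hF₁N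
  have hlaw := positiveLaw_eq N hZcomp hZint hF₁.measurable hF₁N
  have hmeasP : Measurable fun q : Latent dc p × (Fin L → Latent dc p) =>
      (q.1, transition A q.2) :=
    measurable_fst.prodMk ((continuous_transition A).measurable.comp measurable_snd)
  have hac : positiveLaw N Z ≪ (unif Z).prod (unif Z) := by
    rw [hlaw]
    exact withDensity_absolutelyContinuous _ _
  have hPmem' : ∀ᵐ q ∂P, q.1 ∈ Z ∧ transition A q.2 ∈ Z :=
    ae_of_ae_map (p := fun q => q.1 ∈ Z ∧ q.2 ∈ Z) hmeasP.aemeasurable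
      (hPlaw ▸ hac.ae_le (ae_unif_prod_mem hZcomp hZint))
  obtain ⟨K₂, F₂, hF₂, hF₂K, hF₂N⟩ := exists_continuous_distance N hZcomp
    (hadm.continuousOn_h hgcont) hμ
  have hadm₁ : Admissible Z W g A P (inverseModel Z g A μ) :=
    admissible_inverseModel hV0 hZcomp hgcont hginj hA hPmem (hPmem'.mono fun _ h => h.2) hW
  -- The factor `μ` of the comparison model cancels the temperature, so its model distance is the
  -- true distance `F₁` and its cross entropy is the minimal one.
  have hlim₁ := hadm₁.tendsto_contrastiveLoss (μ := μ) hZcomp hZint hPmem' hPlaw hF₁ hF₁K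
    fun q hq => by
      rw [inverseModel_h hV0 hginj hq.1, inverseModel_h hV0 hginj hq.2, ← smul_sub,
        map_smul_eq_mul, Real.norm_of_nonneg hμ.le, mul_div_cancel_left₀ _ hμ.ne', hF₁N q hq]
  have hlim₂ := hadm.tendsto_contrastiveLoss hZcomp hZint hPmem' hPlaw hF₂ hF₂K hF₂N
  have hle₁ := hmin _ hadm₁ _ (hlim₁.add_const (β * mergeLoss Z g η (inverseModel Z g A μ)))
  rw [tendsto_nhds_unique hℓ (hlim₂.add_const (β * mergeLoss Z g η θ)),
    mergeLoss_inverseModel hV0 hZcomp hginj, mul_zero, add_zero] at hle₁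
  have hmerge0 : 0 ≤ mergeLoss Z g η θ := hadm.mergeLoss_nonneg hη
  have hβmerge : 0 ≤ β * mergeLoss Z g η θ := mul_nonneg hβ.le hmerge0
  -- Minimality bounds the cross entropy of `θ` plus `β` times its merge loss by that of the
  -- comparison model. Dropping the nonnegative merge term leaves the hypothesis of the Gibbs lemma.
  have hae := ae_eq_of_crossEntropy_le (ρ := unif Z) (σ := unif Z) hF₁.measurable hF₂.measurable
    (K := max K₁ K₂)
    (fun q => ⟨(hF₁K q).1, (hF₁K q).2.trans (le_max_left _ _)⟩)
    (fun q => ⟨(hF₂K q).1, (hF₂K q).2.trans (le_max_right _ _)⟩)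
    (fun _ => rfl) (fun _ => rfl) (by
      rw [← hlaw]
      linarith)
  have hmerge : mergeLoss Z g η θ = 0 := by
    -- With equal cross entropies, the same inequality leaves no room for a positive merge loss.
    have h1 := integral_congr_ae (hac.ae_le hae)
    rw [h1] at hle₁
    have h2 : β * mergeLoss Z g η θ ≤ 0 := by linarith
    exact le_antisymm (nonpos_of_mul_nonpos_right h2 hβ) hmerge0
  have hcont : ∀ {F : Latent dc p × Latent dc p → ℝ} {K : ℝ}, Continuous F →
      (∀ q, F q ∈ Icc 0 K) → Continuous fun q : Latent dc p × Latent dc p =>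
        F q + Real.log (∫ b, Real.exp (-F (q.1, b)) ∂(unif Z)) := by
    intro F K hF hFK
    refine hF.add (Continuous.log ((continuous_integral_exp_neg hF (fun q => (hFK q).1) _).comp
      continuous_fst) fun q => (integral_exp_pos ?_).ne')
    exact integrable_of_mem_Icc (a := Real.exp (-K)) (b := 1) (by fun_prop) fun b =>
      ⟨Real.exp_le_exp.2 (neg_le_neg (hFK _).2), Real.exp_le_one_iff.2 (neg_nonpos.2 (hFK _).1)⟩
  have heq := eqOn_of_ae_unif_prod hZconv hZcomp hZint (hcont hF₁ hF₁K) (hcont hF₂ hF₂K) hae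
  have hiso : ∀ z ∈ Z, ∀ z' ∈ Z, N (θ.h g z - θ.h g z') = μ * N (z - z') := by
    intro z hz z' hz'
    -- On the diagonal both distances vanish, so the normalizers at `z` agree and cancel from the
    -- identity at `(z, z')`.
    have h1 := heq (⟨hz, hz⟩ : (z, z) ∈ Z ×ˢ Z)
    have h2 := heq (⟨hz, hz'⟩ : (z, z') ∈ Z ×ˢ Z)
    simp only [hF₁N _ (⟨hz, hz⟩ : (z, z) ∈ Z ×ˢ Z), hF₂N _ (⟨hz, hz⟩ : (z, z) ∈ Z ×ˢ Z),
      sub_self, map_zero, zero_div, zero_add] at h1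
    simp only [hF₁N _ (⟨hz, hz'⟩ : (z, z') ∈ Z ×ˢ Z), hF₂N _ (⟨hz, hz'⟩ : (z, z') ∈ Z ×ˢ Z),
      h1, add_left_inj] at h2
    rw [h2]
    field_simp
  have halign := hadm.aligned_of_mergeLoss_eq_zero hZconv hZcomp hZint hgcont hη hmerge
  choose σ hσ using fun v =>
    exists_permMatrix_of_entropy_eq_zero (hadm.doublyStochastic v) (halign v).1
  refine ⟨hiso, ⟨σ, hσ, fun z hz v i => ?_⟩, ?_⟩
  · rw [← (halign v).2 z hz i, Model.sorted, hσ v, Matrix.permMatrix_mulVec]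
    rfl
  obtain ⟨T, w, hw, hT⟩ := N.exists_linear_of_isometric hN hZconv hZint hμ hiso
  have hwZ := interior_subset hw
  have hTinj : Function.Injective T := by
    rw [injective_iff_map_eq_zero]
    intro x hx
    obtain ⟨t, ht, hmem⟩ := exists_pos_add_smul_mem hw x
    have h1 := hT _ hmem
    rw [add_sub_cancel_left, map_smul, hx, smul_zero, add_zero] at h1
    have h2 := hiso _ hmem w hwZ
    rw [h1, sub_self, map_zero, add_sub_cancel_left, map_smul_eq_mul, eq_comm, mul_eq_zero,
      mul_eq_zero, norm_eq_zero] at h2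
    exact hN x ((h2.resolve_left hμ.ne').resolve_left ht.ne')
  -- Moving in a direction invisible to view `v` does not change what `v` observes, and by alignment
  -- `c*` is a function of that observation alone.
  have hview : ∀ v x, viewSource v x = 0 → commonPart (T x) = 0 := by
    intro v x hx
    obtain ⟨t, ht, hmem⟩ := exists_pos_add_smul_mem hw x
    have h1 : viewSource v (w + t • x) = viewSource v w := by
      ext (i | j)
      · simpa [viewSource, ht.ne'] using congrFun hx (Sum.inl i)
      · simpa [viewSource, ht.ne'] using congrFun hx (Sum.inr j)
    ext i
    have h2 : θ.h g (w + t • x) (Sum.inl i) = θ.h g w (Sum.inl i) := by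
      change θ.center g _ i = θ.center g _ i
      rw [← (halign v).2 _ hmem, ← (halign v).2 _ hwZ, Model.sorted, Model.est, h1]
      rfl
    have h3 := congrFun (hT _ hmem) (Sum.inl i)
    rw [h2, add_sub_cancel_left, map_smul, Pi.add_apply, left_eq_add, Pi.smul_apply, smul_eq_mul,
      mul_eq_zero] at h3
    exact h3.resolve_left ht.ne'
  intro z hz z' hz'
  have hdiff : θ.h g z - θ.h g z' = T (z - z') := by
    rw [hT z hz, hT z' hz', add_sub_add_left_eq_sub, ← map_sub, sub_sub_sub_cancel_right]
  have := commonPart_eq_zero_iff_of_viewSource hV hTinj hview (z - z')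
  rw [← hdiff, map_sub, map_sub, sub_eq_zero, sub_eq_zero, funext_iff, funext_iff] at this
  exact this
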